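/- **Setting.** Let $I=[0,1]$ be the action set with Lebesgue measure $\nu$, let $\mathcal X$ be a context set and $\Pi$ a finite set of (measurable) policies $\pi:\mathcal X\to I$ with $|\Pi|\ge 2$. Let $\mathcal D$ be a distribution over pairs $(x,\ell)$ of a context $x\in\mathcal X$ and a loss function $\ell:I\to[0,1]$. The losses are measurable, but no continuity is assumed. In each round $t=1,\dots,T$, $(x_t,\ell_t)\sim\mathcal D$ is drawn independently of the past, the learner sees $x_t$, plays $a_t\in I$, and observes and suffers the loss $\ell_t(a_t)$. The marginal of $\mathcal D$ on $\mathcal X$ is known to the learner. For $h>0$ let $B_h(a)=[a-h,a+h]\cap[0,1]$, let $\mathrm{Smooth}_h(a)$ be the uniform distribution over $B_h(a)$, and let $\mathrm{Smooth}_{\pi,h}(\cdot\,|\,x)$ be the $\nu$-density of $\mathrm{Smooth}_h(\pi(x))$. Put $\lambda_h(\pi)=\mathbb E_{(x,\ell)\sim\mathcal D}\,\mathbb E_{a\sim\mathrm{Smooth}_h(\pi(x))}[\ell(a)]$ and $$\mathrm{Regret}(T,\Pi_h)=\mathbb E\Big[\sum_{t=1}^T\ell_t(a_t)\Big]-T\min_{\pi\in\Pi}\lambda_h(\pi).$$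 **Algorithm** (SmoothPolicyElimination with bandwidth $h$, policy set $\Pi$ and horizon $T\ge2$). Put $\delta_T=5\lceil\log(T|\Pi|\log_2T)\rceil$ and $\Pi^{(1)}=\Pi$. In epoch $m=1,2,\dots$ put $r_m=2^{-m}$, $\mu_m=\min\{1/2,r_m\}$, $V_m=\mathbb E_x\,\nu\big(\bigcup_{\pi\in\Pi^{(m)}}B_h(\pi(x))\big)$ and $\tilde n_m=\lceil 320V_m/(r_m^2h)\rceil$. The epoch lasts $\tilde n_m\delta_T$ rounds (the last epoch is cut off after round $T$). Let $Q_m$ be a distribution on $\Pi^{(m)}$ that minimizes $$\max_{\pi\in\Pi^{(m)}}\mathbb E_x\,\mathbb E_{a\sim\mathrm{Smooth}_h(\pi(x))}\Big[\frac1{q_m(a|x)}\Big],\qquad q_m(a|x)=\mu_m+(1-\mu_m)\,\mathbb E_{\pi\sim Q_m}\mathrm{Smooth}_{\pi,h}(a|x),$$ chosen as a function of $m$ and $\Pi^{(m)}$. In each round $t$ of the epoch, play $a_t\sim q_m(\cdot|x_t)$. For $\pi\in\Pi^{(m)}$ let $\hat L_m(\pi)$ be the median, over the $\delta_T$ consecutive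 batches of $\tilde n_m$ rounds of the epoch, of the batch averages of $\mathrm{Smooth}_{\pi,h}(a_t|x_t)\,\ell_t(a_t)/q_m(a_t|x_t)$, and put $\Pi^{(m+1)}=\{\pi\in\Pi^{(m)}:\hat L_m(\pi)\le\min_{\pi'\in\Pi^{(m)}}\hat L_m(\pi')+3r_m\}$. **Claim.** The minimizers required by the algorithm exist, and for every choice of them $$\mathrm{Regret}(T,\Pi_h)\le\tilde O\Big(\sqrt{\tfrac Th\log|\Pi|}\Big),$$ that is, there are absolute constants $C>0$ and $c\in\mathbb N$ such that, for all $h>0$, $T\ge2$, $\mathcal X$, $\Pi$ with $|\Pi|\ge2$, and $\mathcal D$, $\mathrm{Regret}(T,\Pi_h)\le C(\log T)^c\sqrt{\tfrac Th\log|\Pi|}$. -/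

import Mathlib

open MeasureTheory ProbabilityTheory unitInterval

noncomputable section

namespace SmoothedBandit

/-! ### The contextual bandit problem

The action set is the unit interval `I = [0,1]` with the metric `|a - a'|` and Lebesgue measure
`volume`.  A problem instance is a probability measure `D` on `X × E` and a loss `ℓ : E → I → ℝ`
with values in `[0,1]`: drawing `(x, e)` from `D` means drawing the context `x` together with the
loss function `ℓ e`.  A finite policy set is a finite type `P` with a family `π : P → X → I`. -/

variable {X E P : Type*}

/-- `Smooth_h(a)`: the uniform distribution over the closed ball `[a - h, a + h] ∩ [0,1]`. -/
def smooth (h : ℝ) (a : I) : Measure I :=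
  ProbabilityTheory.cond volume (Metric.closedBall a h)

/-- The density of `Smooth_h(a)` with respect to Lebesgue measure, evaluated at `b`. -/
def smoothDensity (h : ℝ) (a b : I) : ℝ :=
  (Metric.closedBall a h).indicator (fun _ => (volume.real (Metric.closedBall a h))⁻¹) b

/-- The smoothed loss `λ_h(π) = E_{(x,ℓ) ∼ D} E_{a ∼ Smooth_h(π(x))} ℓ(a)` of a policy. -/
def smoothedLoss [MeasurableSpace X] [MeasurableSpace E] (D : Measure (X × E)) (ℓ : E → I → ℝ)
    (h : ℝ) (pol : X → I) : ℝ :=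
  ∫ z, ∫ a, ℓ z.2 a ∂(smooth h (pol z.1)) ∂D

/-- The benchmark: the smallest smoothed loss of a policy in the class. -/
def bench [MeasurableSpace X] [MeasurableSpace E] (D : Measure (X × E)) (ℓ : E → I → ℝ)
    (h : ℝ) (π : P → X → I) : ℝ :=
  ⨅ p, smoothedLoss D ℓ h (π p)

/-- A (randomized) learner.  In round `t` (counted from `0`), given the contexts, actions and
observed losses of the `t` previous rounds and the current context `x`, it plays an action drawn
from the distribution on `[0,1]` whose Lebesgue density is `A t past x`. -/
abbrev Learner (X : Type*) := (t : ℕ) → (Fin t → X × I × ℝ) → X → I → ℝ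

/-- What the learner has seen before round `t`.  Here `ω s = ((x_s, e_s), a_s)`, and only the loss
`ℓ e_s a_s` of the played action is revealed. -/
def past (ℓ : E → I → ℝ) {T : ℕ} (ω : Fin T → (X × E) × I) (t : Fin T) : Fin t → X × I × ℝ :=
  fun s =>
    let z := ω (Fin.castLE t.isLt.le s)
    (z.1.1, z.2, ℓ z.1.2 z.2)

/-- The joint law of contexts, losses and actions in `T` rounds.  In each round `(x_t, e_t)` is drawn
from `D` independently of the past, and given the past and `(x_t, e_t)` the action `a_t` has density
`A t past x_t`; so the joint density with respect to `(D ⊗ volume)^T` is the product of these. -/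
def interactionLaw [MeasurableSpace X] [MeasurableSpace E] (D : Measure (X × E)) (ℓ : E → I → ℝ)
    (A : Learner X) (T : ℕ) : Measure (Fin T → (X × E) × I) :=
  (Measure.pi fun _ : Fin T => D.prod (volume : Measure I)).withDensity fun ω =>
    ∏ t : Fin T, ENNReal.ofReal (A t (past ℓ ω t) (ω t).1.1 (ω t).2)

/-- The smoothed regret `E[∑_t ℓ_t(a_t)] - T · min_π λ_h(π)`. -/
def smoothedRegret [MeasurableSpace X] [MeasurableSpace E] (D : Measure (X × E)) (ℓ : E → I → ℝ)
    (h : ℝ) (π : P → X → I) (A : Learner X) (T : ℕ) : ℝ :=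
  (∫ ω, ∑ t, ℓ (ω t).1.2 (ω t).2 ∂(interactionLaw D ℓ A T)) - T * bench D ℓ h π

/-! ### The algorithm SmoothPolicyElimination

Epochs are counted from `0` here: epoch `k` below is the epoch `m = k + 1` of the usual
description. -/

/-- The number of batches `5 ⌈log (T N log₂ T)⌉`, where `N` is the number of policies. -/
def numBatches (T N : ℕ) : ℕ := 5 * ⌈Real.log (T * N * Real.logb 2 T)⌉₊

/-- The radius `r_m = 2^{-m}` for `m = k + 1`. -/
def radius (k : ℕ) : ℝ := (1 / 2) ^ (k + 1)

/-- The exploration probability `min {1/2, r_m}`. -/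
def exploreProb (k : ℕ) : ℝ := min (1 / 2) (radius k)

/-- The characteristic volume of a set `S` of policies: the expected Lebesgue measure of the union
of the balls around the actions that they choose. -/
def charVolume [MeasurableSpace X] (DX : Measure X) (h : ℝ) (π : P → X → I) (S : Finset P) : ℝ :=
  ∫ x, volume.real (⋃ p ∈ S, Metric.closedBall (π p x) h) ∂DX

/-- The batch size `320 V / (r² h)`, rounded up to an integer. -/
def batchSize [MeasurableSpace X] (DX : Measure X) (h : ℝ) (π : P → X → I) (k : ℕ)
    (S : Finset P) : ℕ :=
  ⌈320 * charVolume DX h π S / (radius k ^ 2 * h)⌉₊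

/-- The action density `q(a|x) = μ + (1 - μ) E_{π ∼ Q} Smooth_{π,h}(a|x)`. -/
def mixDensity [Fintype P] (h μ : ℝ) (π : P → X → I) (Q : P → ℝ) (x : X) (a : I) : ℝ :=
  μ + (1 - μ) * ∑ p, Q p * smoothDensity h (π p x) a

/-- The probability distributions on the set `S` of policies. -/
def distributions [Fintype P] (S : Finset P) : Set (P → ℝ) :=
  {Q | Q ∈ stdSimplex ℝ P ∧ ∀ p ∉ S, Q p = 0}

/-- The objective `max_{π ∈ S} E_x E_{a ∼ Smooth_h(π(x))} [1 / q(a|x)]`. -/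
def objective [Fintype P] [MeasurableSpace X] (DX : Measure X) (h μ : ℝ) (π : P → X → I)
    (S : Finset P) (Q : P → ℝ) : ℝ :=
  ⨆ p : S, ∫ x, ∫ a, (mixDensity h μ π Q x a)⁻¹ ∂(smooth h (π p x)) ∂DX

/-- `Q` solves the optimization problem of the algorithm: in epoch `k` with the nonempty version
space `S`, the distribution `Q k S` on `S` minimizes the objective. -/
def IsOptimizer [Fintype P] [MeasurableSpace X] (DX : Measure X) (h : ℝ) (π : P → X → I)
    (Q : ℕ → Finset P → P → ℝ) : Prop :=
  ∀ (k : ℕ) (S : Finset P), S.Nonempty →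
    Q k S ∈ distributions S ∧
      IsMinOn (objective DX h (exploreProb k) π S) (distributions S) (Q k S)

/-- The median of `n` real numbers (the mean of the two middle ones when `n` is even). -/
def median {n : ℕ} (f : Fin n → ℝ) : ℝ :=
  if hn : 0 < n then
    (f (Tuple.sort f ⟨(n - 1) / 2, by omega⟩) + f (Tuple.sort f ⟨n / 2, by omega⟩)) / 2
  else 0

/-- The average over the `i`-th batch of `n` rounds, in an epoch that begins with round `start`, of
the importance weighted losses `Smooth_{π,h}(a_t|x_t) ℓ_t(a_t) / q(a_t|x_t)` of the policy `p`. -/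
def batchEstimate [Fintype P] (h μ : ℝ) (π : P → X → I) (Q : P → ℝ) (start n : ℕ)
    {t : ℕ} (z : Fin t → X × I × ℝ) (i : ℕ) (p : P) : ℝ :=
  (∑ s ∈ Finset.univ.filter
      (fun s : Fin t => start + i * n ≤ (s : ℕ) ∧ (s : ℕ) < start + (i + 1) * n),
    smoothDensity h (π p (z s).1) (z s).2.1 * (z s).2.2 / mixDensity h μ π Q (z s).1 (z s).2.1) / n

open Classical in
/-- The first round and the version space of epoch `k`, computed from the data `z` of the first `t`
rounds (it is meaningful, and is used below, only if epoch `k` begins no later than round `t`).  The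
version space of the next epoch consists of the policies whose median of batch estimates is within
`3 r` of the smallest one. -/
def epochState [Fintype P] [MeasurableSpace X] (DX : Measure X) (h : ℝ) (π : P → X → I) (T : ℕ)
    (Q : ℕ → Finset P → P → ℝ) {t : ℕ} (z : Fin t → X × I × ℝ) : ℕ → ℕ × Finset P
  | 0 => (0, Finset.univ)
  | k + 1 =>
    let start := (epochState DX h π T Q z k).1
    let S := (epochState DX h π T Q z k).2
    let n := batchSize DX h π k S
    let d := numBatches T (Fintype.card P)
    let est : P → ℝ := fun p =>
      median fun i : Fin d => batchEstimate h (exploreProb k) π (Q k S) start n z i p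
    (start + n * d, {p ∈ S | ∀ p' ∈ S, est p ≤ est p' + 3 * radius k})

/-- SmoothPolicyElimination with bandwidth `h`, policies `π`, horizon `T`, the marginal distribution
`DX` of the contexts, and the solutions `Q` of its optimization problems.  In round `t` it plays the
action density of the latest epoch that has begun. -/
def smoothPolicyElimination [Fintype P] [MeasurableSpace X] (DX : Measure X) (h : ℝ)
    (π : P → X → I) (T : ℕ) (Q : ℕ → Finset P → P → ℝ) : Learner X :=
  fun t z x a =>
    let k := Nat.findGreatest (fun k => (epochState DX h π T Q z k).1 ≤ t) t
    mixDensity h (exploreProb k) π (Q k (epochState DX h π T Q z k).2) x a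

end SmoothedBandit

end

open SmoothedBandit

/-! The proof combines a variance bound for importance weighting, a median-of-means deviation bound
in each epoch, and a deterministic summation of radii.

Variance. The importance weighted loss of a policy is unbiased, and its second moment is at most
`1/h` times `E_x E_{a ∼ Smooth}[1/q]` when `h ≤ 1`. For the algorithm's optimizer the latter is at
most `2V`, where `V` is the characteristic volume. It suffices to exhibit one distribution with this
property (`exists_integral_div_mixDensity_le`). No minimax theorem is used: a maximizer of the
integral of `log q` over the region covered by the surviving balls works. The first-order condition
towards the vertex `p` says that replacing the mixture of `Q` by the smoothed `p` does not increase
the integral of `(·)/q`, and the mixture itself gives at most `V/(1-μ) ≤ 2V`.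

Deviation. By Chebyshev, a batch of `320V/(r²h)` rounds misses the true loss by more than `r` with
probability at most `1/160`. Give a bad batch weight 160 and a good one weight 1. The product over
`d` batches has mean at most `2^d`, but is at least `12^d` if the median is off, so the median fails
with probability at most `6^{-d}` (`pow_mul_measure_epochEstimate_le`). This pays for a union over
`T` epochs and all policies, with a factor `1/T` to spare.

Adaptivity. The start and the version space of an epoch are random. An event that fixes both is
decided before the epoch begins and forces one action density during the whole epoch, so on it these
rounds are independent and identically distributed (`lintegral_interactionLaw_mul`). Events for
different states are disjoint, so summing over states costs nothing.

Regret. If all estimates are accurate, the best policy survives and each survivor of epoch `k` is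
within `10 r_k` of it. Exploration adds `r_k`, so a round costs at most `11 r_k`. As `V ≤ 1`, epochs
with radius above a threshold `ρ` contribute about `d/(hρ)` and the others at most `Tρ`. The choice
`ρ = √(d/(Th))` gives `√(dT/h)`, and `d` is of order at most `log²T · log|Π|`. The remaining cases
are easy: for `d ≥ Th` the trivial bound `T` suffices, and for `h ≥ 1` the regret vanishes. -/

noncomputable section

namespace SmoothedBandit

set_option linter.unusedSectionVars false

variable {X E P : Type*}

/-! ### The interaction law -/

/-- The observations of a learner in `t` completed rounds. -/
def history (ℓ : E → I → ℝ) {t : ℕ} (ω : Fin t → (X × E) × I) : Fin t → X × I × ℝ :=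
  fun s => ((ω s).1.1, (ω s).2, ℓ (ω s).1.2 (ω s).2)

lemma past_eq_history (ℓ : E → I → ℝ) {T : ℕ} (ω : Fin T → (X × E) × I) (t : Fin T) :
    past ℓ ω t = history ℓ fun s : Fin t => ω (Fin.castLE t.isLt.le s) := rfl

lemma past_append_left (ℓ : E → I → ℝ) {u n : ℕ} (a : Fin u → (X × E) × I)
    (b : Fin n → (X × E) × I) (t : Fin u) :
    past ℓ (Fin.append a b) (Fin.castAdd n t) = past ℓ a t := by
  funext s
  have : Fin.append a b (Fin.castLE (Fin.castAdd n t).isLt.le s) = a (Fin.castLE t.isLt.le s) :=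
    Fin.append_left a b (Fin.castLE t.isLt.le s)
  simp only [past, this]

section Law

variable [MeasurableSpace X] [MeasurableSpace E]

/-- The action densities of a learner are jointly measurable and integrate to one. -/
structure IsRegularLearner (A : Learner X) : Prop where
  measurable : ∀ t, Measurable fun y : (Fin t → X × I × ℝ) × X × I => A t y.1 y.2.1 y.2.2
  lintegral_eq_one : ∀ t z x, ∫⁻ a, ENNReal.ofReal (A t z x a) = 1

/-- The density of the `t`-th action given the rounds before it. -/
def stepDensity (ℓ : E → I → ℝ) (A : Learner X) {T : ℕ} (ω : Fin T → (X × E) × I) (t : Fin T) :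
    ENNReal :=
  ENNReal.ofReal (A t (past ℓ ω t) (ω t).1.1 (ω t).2)

lemma stepDensity_append_left (ℓ : E → I → ℝ) (A : Learner X) {u n : ℕ}
    (a : Fin u → (X × E) × I) (b : Fin n → (X × E) × I) (t : Fin u) :
    stepDensity ℓ A (Fin.append a b) (Fin.castAdd n t) = stepDensity ℓ A a t := by
  unfold stepDensity
  rw [past_append_left, Fin.append_left]
  rfl

lemma measurable_append {Ω : Type*} [MeasurableSpace Ω] (u n : ℕ) :
    Measurable fun p : (Fin u → Ω) × (Fin n → Ω) => Fin.append p.1 p.2 := by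
  refine measurable_pi_lambda _ fun i => ?_
  refine Fin.addCases (fun j => ?_) (fun j => ?_) i
  · simp only [Fin.append_left]; fun_prop
  · simp only [Fin.append_right]; fun_prop

lemma measurePreserving_append {Ω : Type*} [MeasurableSpace Ω] (β : Measure Ω)
    [IsProbabilityMeasure β] (u n : ℕ) :
    MeasurePreserving (fun p : (Fin u → Ω) × (Fin n → Ω) => Fin.append p.1 p.2)
      ((Measure.pi fun _ => β).prod (Measure.pi fun _ => β)) (Measure.pi fun _ => β) := by
  refine ⟨measurable_append u n, ?_⟩
  symm
  refine Measure.pi_eq fun s hs => ?_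
  rw [Measure.map_apply (measurable_append u n) (MeasurableSet.univ_pi hs)]
  have : (fun p : (Fin u → Ω) × (Fin n → Ω) => Fin.append p.1 p.2) ⁻¹' (Set.univ.pi s) =
      (Set.univ.pi fun i => s (Fin.castAdd n i)) ×ˢ (Set.univ.pi fun i => s (Fin.natAdd u i)) := by
    ext p
    simp only [Set.mem_preimage, Set.mem_pi, Set.mem_univ, true_imp_iff, Set.mem_prod]
    constructor
    · intro h
      exact ⟨fun i => by simpa using h (Fin.castAdd n i),
        fun i => by simpa using h (Fin.natAdd u i)⟩
    · rintro ⟨h1, h2⟩ i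
      refine Fin.addCases (fun j => ?_) (fun j => ?_) i
      · simpa using h1 j
      · simpa using h2 j
  rw [this, Measure.prod_prod, Measure.pi_pi, Measure.pi_pi, Fin.prod_univ_add]

variable {ℓ : E → I → ℝ} {A : Learner X}

lemma measurable_history (hℓ : Measurable (Function.uncurry ℓ)) (t : ℕ) :
    Measurable fun ω : Fin t → (X × E) × I => history ℓ ω := by
  refine measurable_pi_lambda _ fun s => ?_
  have h : Measurable fun ω : Fin t → (X × E) × I => ((ω s).1.2, (ω s).2) := by fun_prop
  have h' := hℓ.comp h
  have h2 : Measurable fun ω : Fin t → (X × E) × I => (ω s).1.1 := by fun_prop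
  have h3 : Measurable fun ω : Fin t → (X × E) × I => (ω s).2 := by fun_prop
  exact h2.prodMk (h3.prodMk h')

lemma measurable_stepDensity (hℓ : Measurable (Function.uncurry ℓ)) (hA : IsRegularLearner A)
    {T : ℕ} (t : Fin T) :
    Measurable fun ω : Fin T → (X × E) × I => stepDensity ℓ A ω t := by
  have h1 : Measurable fun ω : Fin T → (X × E) × I => past ℓ ω t :=
    (measurable_history hℓ t).comp (measurable_pi_lambda _ fun s => measurable_pi_apply _)
  have h2 : Measurable fun ω : Fin T → (X × E) × I => (ω t).1.1 := by fun_prop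
  have h3 : Measurable fun ω : Fin T → (X × E) × I => (ω t).2 := by fun_prop
  exact ((hA.measurable t).comp (h1.prodMk (h2.prodMk h3))).ennreal_ofReal

variable (D : Measure (X × E)) [IsProbabilityMeasure D]

lemma lintegral_interactionLaw (hℓ : Measurable (Function.uncurry ℓ)) (hA : IsRegularLearner A)
    (T : ℕ) {F : (Fin T → (X × E) × I) → ENNReal} (hF : Measurable F) :
    ∫⁻ ω, F ω ∂(interactionLaw D ℓ A T) =
      ∫⁻ ω, (∏ t, stepDensity ℓ A ω t) * F ω
        ∂(Measure.pi fun _ : Fin T => D.prod (volume : Measure I)) := by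
  unfold interactionLaw
  rw [lintegral_withDensity_eq_lintegral_mul _ _ hF]
  · rfl
  · exact Finset.measurable_fun_prod _ fun t _ => measurable_stepDensity hℓ hA t

lemma lintegral_pi_append {Ω : Type*} [MeasurableSpace Ω] (β : Measure Ω)
    [IsProbabilityMeasure β] (u n : ℕ) {G : (Fin (u + n) → Ω) → ENNReal} (hG : Measurable G) :
    ∫⁻ ω, G ω ∂(Measure.pi fun _ => β) =
      ∫⁻ a, ∫⁻ b, G (Fin.append a b) ∂(Measure.pi fun _ => β) ∂(Measure.pi fun _ => β) := by
  rw [← (measurePreserving_append β u n).lintegral_comp hG]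
  exact lintegral_prod _ (hG.comp (measurable_append u n)).aemeasurable

lemma measurable_lintegral_append {Ω : Type*} [MeasurableSpace Ω] (ν : Measure Ω)
    [IsProbabilityMeasure ν] (u n : ℕ) {G : (Fin (u + n) → Ω) → ENNReal} (hG : Measurable G) :
    Measurable fun a : Fin u → Ω => ∫⁻ b, G (Fin.append a b) ∂(Measure.pi fun _ : Fin n => ν) := by
  have h : Measurable fun p : (Fin u → Ω) × (Fin n → Ω) => G (Fin.append p.1 p.2) :=
    hG.comp (measurable_append u n)
  exact h.lintegral_prod_right'

lemma lintegral_const_mul_append {Ω : Type*} [MeasurableSpace Ω] (ν : Measure Ω)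
    {u : ℕ} (n : ℕ) (a : Fin u → Ω) (c : ENNReal) {G : (Fin (u + n) → Ω) → ENNReal}
    (hG : Measurable G) :
    ∫⁻ b, c * G (Fin.append a b) ∂(Measure.pi fun _ : Fin n => ν) =
      c * ∫⁻ b, G (Fin.append a b) ∂(Measure.pi fun _ : Fin n => ν) :=
  lintegral_const_mul _ (hG.comp ((measurable_append u n).comp measurable_prodMk_left))

/-- Action densities of the first `u` rounds do not see later rounds, so Fubini separates them. They
are absorbed in the law with horizon `u`, and only the later densities remain inside. -/
lemma lintegral_interactionLaw_add (hℓ : Measurable (Function.uncurry ℓ))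
    (hA : IsRegularLearner A) (u n : ℕ) {F : (Fin (u + n) → (X × E) × I) → ENNReal}
    (hF : Measurable F) :
    ∫⁻ ω, F ω ∂(interactionLaw D ℓ A (u + n)) =
      ∫⁻ a, ∫⁻ b, (∏ j, stepDensity ℓ A (Fin.append a b) (Fin.natAdd u j)) * F (Fin.append a b)
        ∂(Measure.pi fun _ : Fin n => D.prod (volume : Measure I)) ∂(interactionLaw D ℓ A u) := by
  have hm : Measurable fun ω : Fin (u + n) → (X × E) × I => (∏ t, stepDensity ℓ A ω t) * F ω :=
    (Finset.measurable_fun_prod _ fun t _ => measurable_stepDensity hℓ hA t).mul hF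
  have hm2 : Measurable fun ω : Fin (u + n) → (X × E) × I =>
      (∏ j, stepDensity ℓ A ω (Fin.natAdd u j)) * F ω :=
    (Finset.measurable_fun_prod _ fun t _ => measurable_stepDensity hℓ hA _).mul hF
  have hm4 := measurable_lintegral_append (D.prod (volume : Measure I)) u n hm2
  rw [lintegral_interactionLaw D hℓ hA _ hF, lintegral_pi_append _ u n hm,
    lintegral_interactionLaw D hℓ hA u hm4]
  refine lintegral_congr fun a => ?_
  rw [← lintegral_const_mul_append _ n a _ hm2]
  refine lintegral_congr fun b => ?_
  simp only [Fin.prod_univ_add, stepDensity_append_left, mul_assoc]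

lemma lintegral_interactionLaw_succ (hℓ : Measurable (Function.uncurry ℓ))
    (hA : IsRegularLearner A) (t : ℕ)
    {F : (Fin t → (X × E) × I) → (X × E) × I → ENNReal} (hF : Measurable (Function.uncurry F)) :
    ∫⁻ ω, F (fun s => ω s.castSucc) (ω (Fin.last t)) ∂(interactionLaw D ℓ A (t + 1)) =
      ∫⁻ a, ∫⁻ z, ENNReal.ofReal (A t (history ℓ a) z.1.1 z.2) * F a z
        ∂(D.prod (volume : Measure I)) ∂(interactionLaw D ℓ A t) := by
  rw [lintegral_interactionLaw_add D hℓ hA t 1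
    (F := fun ω => F (fun s => ω s.castSucc) (ω (Fin.last t)))]
  · refine lintegral_congr fun a => ?_
    have hmp := measurePreserving_funUnique (D.prod (volume : Measure I)) (Fin 1)
    rw [← hmp.lintegral_comp_emb (MeasurableEquiv.measurableEmbedding _)]
    refine lintegral_congr fun b => ?_
    have h1 : (fun s : Fin t => Fin.append a b s.castSucc) = a := by
      funext s; exact Fin.append_left a b s
    have h2 : Fin.append a b (Fin.last t) = b 0 := Fin.append_right a b 0
    have h3 : past ℓ (Fin.append a b) (Fin.natAdd t 0) = history ℓ a := by
      rw [past_eq_history]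
      congr 1
    rw [Fin.prod_univ_one, h1, h2]
    congr 1
    unfold stepDensity
    rw [h3, Fin.append_right]
    rfl
  · have hr : Measurable fun (ω : Fin (t + 1) → (X × E) × I) =>
        ((fun s : Fin t => ω s.castSucc), ω (Fin.last t)) :=
      (measurable_pi_lambda _ fun s => measurable_pi_apply _).prodMk (measurable_pi_apply _)
    exact hF.comp hr

lemma lintegral_action_eq_one (hA : IsRegularLearner A) (t : ℕ)
    (z : Fin t → X × I × ℝ) :
    ∫⁻ y, ENNReal.ofReal (A t z y.1.1 y.2) ∂(D.prod (volume : Measure I)) = 1 := by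
  have hm : Measurable fun y : (X × E) × I => ENNReal.ofReal (A t z y.1.1 y.2) := by
    have h : Measurable fun y : (X × E) × I => (z, y.1.1, y.2) := by fun_prop
    exact ((hA.measurable t).comp h).ennreal_ofReal
  rw [lintegral_prod _ hm.aemeasurable]
  simp [hA.lintegral_eq_one]

/-- The density of the last action integrates to one. Hence the laws for different horizons are
consistent, and events of the first rounds can be moved between horizons. -/
lemma map_castSucc_interactionLaw (hℓ : Measurable (Function.uncurry ℓ))
    (hA : IsRegularLearner A) (t : ℕ) :
    (interactionLaw D ℓ A (t + 1)).map (fun ω s => ω (Fin.castSucc s)) =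
      interactionLaw D ℓ A t := by
  have hr : Measurable fun (ω : Fin (t + 1) → (X × E) × I) (s : Fin t) => ω s.castSucc :=
    measurable_pi_lambda _ fun s => measurable_pi_apply _
  refine Measure.ext_of_lintegral _ fun f hf => ?_
  rw [lintegral_map hf hr,
    lintegral_interactionLaw_succ D hℓ hA t (F := fun a _ => f a) (hf.comp measurable_fst)]
  refine lintegral_congr fun a => ?_
  have hm : Measurable fun y : (X × E) × I => ENNReal.ofReal (A t (history ℓ a) y.1.1 y.2) := by
    have h : Measurable fun y : (X × E) × I => (history ℓ a, y.1.1, y.2) := by fun_prop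
    exact ((hA.measurable t).comp h).ennreal_ofReal
  rw [lintegral_mul_const _ hm, lintegral_action_eq_one D hA, one_mul]

lemma map_castLE_interactionLaw (hℓ : Measurable (Function.uncurry ℓ))
    (hA : IsRegularLearner A) {t T : ℕ} (htT : t ≤ T) :
    (interactionLaw D ℓ A T).map (fun ω s => ω (Fin.castLE htT s)) = interactionLaw D ℓ A t := by
  induction T, htT using Nat.le_induction with
  | base => simp
  | succ T hT ih =>
    rw [← ih, ← map_castSucc_interactionLaw D hℓ hA T, Measure.map_map]
    · rfl
    · exact measurable_pi_lambda _ fun s => measurable_pi_apply _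
    · exact measurable_pi_lambda _ fun s => measurable_pi_apply _

lemma isProbabilityMeasure_interactionLaw (hℓ : Measurable (Function.uncurry ℓ))
    (hA : IsRegularLearner A) (T : ℕ) : IsProbabilityMeasure (interactionLaw D ℓ A T) := by
  -- With no rounds the density is the empty product; consistency of the marginals carries the total
  -- mass to horizon `T`.
  have h0 : IsProbabilityMeasure (interactionLaw D ℓ A 0) := by
    refine ⟨?_⟩
    rw [← lintegral_one, lintegral_interactionLaw D hℓ hA 0 measurable_const]
    simp
  have h := map_castLE_interactionLaw D hℓ hA (Nat.zero_le T)
  refine ⟨?_⟩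
  have h1 := congrArg (fun m => m Set.univ) h
  simp only [measure_univ] at h1
  rwa [Measure.map_apply (measurable_pi_lambda _ fun s => measurable_pi_apply _)
    MeasurableSet.univ, Set.preimage_univ] at h1

end Law

/-- On boxes the indicator factors along with the density. This identifies rounds that share one
action density as independent draws. -/
lemma pi_withDensity {Ω : Type*} [MeasurableSpace Ω] (β : Measure Ω) [IsProbabilityMeasure β]
    {q : Ω → ENNReal} (hq : Measurable q) [IsProbabilityMeasure (β.withDensity q)] (n : ℕ) :
    (Measure.pi fun _ : Fin n => β).withDensity (fun b => ∏ j, q (b j)) =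
      Measure.pi fun _ : Fin n => β.withDensity q := by
  symm
  refine Measure.pi_eq fun s hs => ?_
  rw [withDensity_apply _ (MeasurableSet.univ_pi hs),
    ← lintegral_indicator (MeasurableSet.univ_pi hs)]
  have h1 : ∀ b : Fin n → Ω, (Set.univ.pi s).indicator (fun b => ∏ j, q (b j)) b =
      ∏ j, (s j).indicator q (b j) := by
    intro b
    by_cases hb : b ∈ Set.univ.pi s
    · rw [Set.indicator_of_mem hb]
      exact Finset.prod_congr rfl fun j _ => (Set.indicator_of_mem (hb j trivial) _).symm
    · rw [Set.indicator_of_notMem hb]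
      simp only [Set.mem_pi, Set.mem_univ, true_imp_iff, not_forall] at hb
      obtain ⟨j, hj⟩ := hb
      exact (Finset.prod_eq_zero (Finset.mem_univ j) (Set.indicator_of_notMem hj _)).symm
  simp_rw [h1]
  rw [lintegral_prod_eq_prod_lintegral_of_indepFun Finset.univ
    (fun j (b : Fin n → Ω) => (s j).indicator q (b j))]
  · refine Finset.prod_congr rfl fun j _ => ?_
    rw [(measurePreserving_eval (fun _ : Fin n => β) j).lintegral_comp (hq.indicator (hs j)),
      lintegral_indicator (hs j), withDensity_apply _ (hs j)]
  · exact iIndepFun_pi (X := fun j => (s j).indicator q)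
      fun j => (hq.indicator (hs j)).aemeasurable
  · exact fun j => (hq.indicator (hs j)).comp (measurable_pi_apply j)

/-- If an event of the first `u` rounds forces the action density `q` in the next `n` rounds, then
on that event these rounds are independent draws from the law with density `q`. -/
lemma lintegral_interactionLaw_mul [MeasurableSpace X] [MeasurableSpace E]
    {ℓ : E → I → ℝ} {A : Learner X} (D : Measure (X × E)) [IsProbabilityMeasure D]
    (hℓ : Measurable (Function.uncurry ℓ)) (hA : IsRegularLearner A) (u n : ℕ)
    {q : (X × E) × I → ENNReal} (hq : Measurable q)
    [IsProbabilityMeasure ((D.prod (volume : Measure I)).withDensity q)]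
    {f : (Fin u → (X × E) × I) → ENNReal} (hf : Measurable f)
    {H : (Fin n → (X × E) × I) → ENNReal} (hH : Measurable H)
    (hforce : ∀ a b, f a ≠ 0 → ∀ j : Fin n,
      stepDensity ℓ A (Fin.append a b) (Fin.natAdd u j) = q (b j)) :
    ∫⁻ ω, f (fun s => ω (Fin.castAdd n s)) * H (fun j => ω (Fin.natAdd u j))
        ∂(interactionLaw D ℓ A (u + n)) =
      (∫⁻ a, f a ∂(interactionLaw D ℓ A u)) *
        ∫⁻ b, H b ∂(Measure.pi fun _ : Fin n => (D.prod (volume : Measure I)).withDensity q) := by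
  rw [lintegral_interactionLaw_add D hℓ hA]
  · rw [← lintegral_mul_const _ hf]
    refine lintegral_congr fun a => ?_
    have hqn : Measurable fun b : Fin n → (X × E) × I => ∏ j, q (b j) :=
      Finset.measurable_fun_prod _ fun j _ => hq.comp (measurable_pi_apply j)
    rw [← pi_withDensity _ hq, lintegral_withDensity_eq_lintegral_mul _ hqn hH,
      ← lintegral_const_mul _ (hqn.mul hH)]
    refine lintegral_congr fun b => ?_
    simp only [Fin.append_left, Fin.append_right, Pi.mul_apply]
    -- Where `f` vanishes both sides are zero, so the density has to be known only on the support of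
    -- `f`.
    by_cases ha : f a = 0
    · simp [ha]
    · rw [Finset.prod_congr rfl fun j _ => hforce a b ha j]
      ring
  · exact (hf.comp (measurable_pi_lambda _ fun s => measurable_pi_apply _)).mul
      (hH.comp (measurable_pi_lambda _ fun s => measurable_pi_apply _))

/-! ### Smoothed actions -/

/-- Truncation to the unit interval leaves one half of the ball intact, `[a-h, a]` or `[a, a+h]`,
unless both stick out, and then the ball is everything. -/
lemma min_le_volume_closedBall {h : ℝ} (hh : 0 < h) (a : I) :
    min h 1 ≤ volume.real (Metric.closedBall a h) := by
  have key : ∀ x y : I, (∀ b : I, x ≤ b → b ≤ y → dist b a ≤ h) →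
      (y : ℝ) - x ≤ volume.real (Metric.closedBall a h) := by
    intro x y hxy
    have h1 : volume.real (Set.Icc x y) ≤ volume.real (Metric.closedBall a h) :=
      measureReal_mono fun b hb => hxy b hb.1 hb.2
    refine le_trans ?_ h1
    rw [measureReal_def, unitInterval.volume_Icc, ENNReal.toReal_ofReal']
    exact le_max_left _ _
  have ha0 := a.2.1
  have ha1 := a.2.2
  have hd : ∀ b : I, dist b a = |(b : ℝ) - a| := fun b => rfl
  by_cases h1 : h ≤ a
  · refine (min_le_left _ _).trans ?_
    have := key ⟨a - h, by linarith, by linarith⟩ a fun b hb1 hb2 => by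
      rw [hd, abs_le]
      have : (a : ℝ) - h ≤ b := hb1
      have : (b : ℝ) ≤ a := hb2
      constructor <;> linarith
    simpa using this
  · by_cases h2 : (a : ℝ) + h ≤ 1
    · refine (min_le_left _ _).trans ?_
      have := key a ⟨a + h, by linarith, by linarith⟩ fun b hb1 hb2 => by
        rw [hd, abs_le]
        have : (a : ℝ) ≤ b := hb1
        have : (b : ℝ) ≤ a + h := hb2
        constructor <;> linarith
      simpa using this
    · refine (min_le_right _ _).trans ?_
      have := key 0 1 fun b hb1 hb2 => by
        rw [hd, abs_le]
        have := b.2.1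
        have := b.2.2
        push Not at h1 h2
        constructor <;> linarith
      simpa using this

lemma volume_closedBall_pos {h : ℝ} (hh : 0 < h) (a : I) :
    0 < volume.real (Metric.closedBall a h) :=
  (lt_min hh one_pos).trans_le (min_le_volume_closedBall hh a)

lemma measurableSet_dist_le (h : ℝ) : MeasurableSet {p : I × I | dist p.2 p.1 ≤ h} :=
  (isClosed_le (continuous_snd.dist continuous_fst) continuous_const).measurableSet

lemma measurable_volume_closedBall (h : ℝ) :
    Measurable fun a : I => volume.real (Metric.closedBall a h) := by
  have := measurable_measure_prodMk_left (ν := (volume : Measure I)) (measurableSet_dist_le h)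
  exact this.ennreal_toReal

lemma measurable_smoothDensity (h : ℝ) :
    Measurable fun p : I × I => smoothDensity h p.1 p.2 := by
  have h1 : (fun p : I × I => smoothDensity h p.1 p.2) =
      {p : I × I | dist p.2 p.1 ≤ h}.indicator
        fun p => (volume.real (Metric.closedBall p.1 h))⁻¹ := by
    funext p
    by_cases hp : dist p.2 p.1 ≤ h <;> simp [smoothDensity, Set.indicator, hp]
  rw [h1]
  exact ((measurable_volume_closedBall h).comp measurable_fst).inv.indicator
    (measurableSet_dist_le h)

lemma smoothDensity_nonneg (h : ℝ) (a b : I) : 0 ≤ smoothDensity h a b :=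
  Set.indicator_nonneg (fun _ _ => inv_nonneg.2 measureReal_nonneg) _

lemma smoothDensity_le {h : ℝ} (hh : 0 < h) (a b : I) : smoothDensity h a b ≤ (min h 1)⁻¹ := by
  refine Set.indicator_le' (g := fun _ => (min h 1)⁻¹) (fun b _ => ?_) (fun _ _ => ?_) b
  · exact inv_anti₀ (lt_min hh one_pos) (min_le_volume_closedBall hh a)
  · exact inv_nonneg.2 (lt_min hh one_pos).le

lemma integral_smooth (h : ℝ) (a : I) (f : I → ℝ) :
    ∫ b, f b ∂(smooth h a) = ∫ b, smoothDensity h a b * f b := by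
  have h1 : ∀ b, smoothDensity h a b * f b =
      (Metric.closedBall a h).indicator
        (fun b => (volume.real (Metric.closedBall a h))⁻¹ * f b) b := by
    intro b
    by_cases hb : b ∈ Metric.closedBall a h <;> simp [smoothDensity, hb]
  simp_rw [h1]
  rw [integral_indicator Metric.isClosed_closedBall.measurableSet, integral_const_mul, smooth,
    ProbabilityTheory.cond, integral_smul_measure, ENNReal.toReal_inv]
  rfl

lemma integral_smoothDensity {h : ℝ} (hh : 0 < h) (a : I) : ∫ b, smoothDensity h a b = 1 := by
  unfold smoothDensity
  rw [integral_indicator Metric.isClosed_closedBall.measurableSet, setIntegral_const, smul_eq_mul]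
  exact mul_inv_cancel₀ (volume_closedBall_pos hh a).ne'

lemma smoothDensity_of_one_le {h : ℝ} (hh : 1 ≤ h) (a b : I) : smoothDensity h a b = 1 := by
  have : Metric.closedBall a h = Set.univ := by
    refine Set.eq_univ_of_forall fun b => ?_
    rw [Metric.mem_closedBall]
    refine le_trans ?_ hh
    change |(b : ℝ) - a| ≤ 1
    have := a.2.1; have := a.2.2; have := b.2.1; have := b.2.2
    rw [abs_le]; constructor <;> linarith
  simp [smoothDensity, this]

section Mix

variable [Fintype P] [MeasurableSpace X]

lemma measurable_smoothDensity_comp {h : ℝ} {pol : X → I} (hp : Measurable pol) :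
    Measurable fun y : X × I => smoothDensity h (pol y.1) y.2 :=
  (measurable_smoothDensity h).comp ((hp.comp measurable_fst).prodMk measurable_snd)

lemma measurable_mixDensity {h μ : ℝ} {π : P → X → I} (hπ : ∀ p, Measurable (π p)) (Q : P → ℝ) :
    Measurable fun y : X × I => mixDensity h μ π Q y.1 y.2 := by
  unfold mixDensity
  refine measurable_const.add (measurable_const.mul (Finset.measurable_fun_sum _ fun p _ => ?_))
  exact measurable_const.mul (measurable_smoothDensity_comp (hπ p))

lemma le_mixDensity {h μ : ℝ} (hμ : μ ≤ 1) {π : P → X → I} {Q : P → ℝ} (hQ : ∀ p, 0 ≤ Q p)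
    (x : X) (a : I) : μ ≤ mixDensity h μ π Q x a := by
  have : 0 ≤ (1 - μ) * ∑ p, Q p * smoothDensity h (π p x) a :=
    mul_nonneg (by linarith)
      (Finset.sum_nonneg fun p _ => mul_nonneg (hQ p) (smoothDensity_nonneg h _ _))
  unfold mixDensity
  linarith

lemma integrable_smoothDensity {h : ℝ} (hh : 0 < h) (a : I) :
    Integrable (smoothDensity h a) := by
  refine Integrable.of_bound (C := (min h 1)⁻¹)
    ((measurable_smoothDensity h).comp measurable_prodMk_left).aestronglyMeasurable
    (Filter.Eventually.of_forall fun b => ?_)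
  rw [Real.norm_of_nonneg (smoothDensity_nonneg h a b)]
  exact smoothDensity_le hh a b

lemma integrable_mixDensity {h μ : ℝ} (hh : 0 < h) (π : P → X → I) (Q : P → ℝ) (x : X) :
    Integrable (mixDensity h μ π Q x) := by
  unfold mixDensity
  refine (integrable_const _).add (Integrable.const_mul ?_ _)
  exact integrable_finsetSum _ fun p _ => (integrable_smoothDensity hh _).const_mul _

lemma integral_mixDensity {h μ : ℝ} (hh : 0 < h) (π : P → X → I) {Q : P → ℝ}
    (hQ : ∑ p, Q p = 1) (x : X) : ∫ a, mixDensity h μ π Q x a = 1 := by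
  have hi : ∀ p ∈ Finset.univ, Integrable fun a => Q p * smoothDensity h (π p x) a :=
    fun p _ => (integrable_smoothDensity hh _).const_mul _
  unfold mixDensity
  rw [integral_add (integrable_const _) ((integrable_finsetSum _ hi).const_mul _),
    integral_const_mul, integral_finsetSum _ hi]
  simp [integral_const_mul, integral_smoothDensity hh, hQ]

lemma lintegral_mixDensity {h μ : ℝ} (hh : 0 < h) (hμ0 : 0 ≤ μ) (hμ : μ ≤ 1) (π : P → X → I)
    {Q : P → ℝ} (hQ : Q ∈ stdSimplex ℝ P) (x : X) :
    ∫⁻ a, ENNReal.ofReal (mixDensity h μ π Q x a) = 1 := by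
  rw [← ofReal_integral_eq_lintegral_ofReal (integrable_mixDensity hh π Q x)
    (Filter.Eventually.of_forall fun a => hμ0.trans (le_mixDensity hμ hQ.1 x a)),
    integral_mixDensity hh π hQ.2, ENNReal.ofReal_one]

lemma mixDensity_le {h μ : ℝ} (hh : 0 < h) (hμ0 : 0 ≤ μ) (hμ : μ ≤ 1) (π : P → X → I)
    {Q : P → ℝ} (hQ : Q ∈ stdSimplex ℝ P) (x : X) (a : I) :
    mixDensity h μ π Q x a ≤ (min h 1)⁻¹ := by
  have h1 : ∑ p, Q p * smoothDensity h (π p x) a ≤ (min h 1)⁻¹ := by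
    calc ∑ p, Q p * smoothDensity h (π p x) a ≤ ∑ p, Q p * (min h 1)⁻¹ :=
          Finset.sum_le_sum fun p _ =>
            mul_le_mul_of_nonneg_left (smoothDensity_le hh _ _) (hQ.1 p)
      _ = (min h 1)⁻¹ := by rw [← Finset.sum_mul, hQ.2, one_mul]
  have h2 : 1 ≤ (min h 1)⁻¹ := (one_le_inv₀ (lt_min hh one_pos)).2 (min_le_right _ _)
  unfold mixDensity
  nlinarith [mul_le_mul_of_nonneg_left h1 (sub_nonneg.2 hμ), mul_le_mul_of_nonneg_left h2 hμ0]

lemma mixDensity_of_one_le {h μ : ℝ} (hh : 1 ≤ h) (π : P → X → I) {Q : P → ℝ}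
    (hQ : ∑ p, Q p = 1) (x : X) (a : I) : mixDensity h μ π Q x a = 1 := by
  simp [mixDensity, smoothDensity_of_one_le hh, hQ]

lemma radius_pos (k : ℕ) : 0 < radius k := by unfold radius; positivity

lemma radius_le_half (k : ℕ) : radius k ≤ 1 / 2 := by
  unfold radius
  rw [pow_succ]
  have : ((1 : ℝ) / 2) ^ k ≤ 1 := pow_le_one₀ (by norm_num) (by norm_num)
  linarith

/-- The cap `1/2` is never active beyond equality, since the first radius is already `1/2`. -/
lemma exploreProb_eq (k : ℕ) : exploreProb k = radius k := min_eq_right (radius_le_half k)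

lemma exploreProb_pos (k : ℕ) : 0 < exploreProb k := exploreProb_eq k ▸ radius_pos k

lemma exploreProb_le_half (k : ℕ) : exploreProb k ≤ 1 / 2 := min_le_left _ _

end Mix

/-! ### The optimization problem -/

section Optimizer

variable [Fintype P] [MeasurableSpace X] {h μ : ℝ} {π : P → X → I}

lemma continuous_mixDensity (h μ : ℝ) (π : P → X → I) (x : X) (a : I) :
    Continuous fun Q : P → ℝ => mixDensity h μ π Q x a := by
  unfold mixDensity
  fun_prop

lemma integrable_div_mixDensity (DX : Measure X) [IsFiniteMeasure DX] (hμ0 : 0 < μ) (hμ : μ ≤ 1)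
    (hπ : ∀ p, Measurable (π p)) {Q : P → ℝ} (hQ : ∀ p, 0 ≤ Q p) {g : X × I → ℝ}
    (hg : Measurable g) {C : ℝ} (hC : ∀ y, |g y| ≤ C) :
    Integrable (fun y => g y * (mixDensity h μ π Q y.1 y.2)⁻¹)
      (DX.prod (volume : Measure I)) := by
  refine Integrable.of_bound (C := C * μ⁻¹)
    (hg.mul (measurable_mixDensity hπ Q).inv).aestronglyMeasurable
    (Filter.Eventually.of_forall fun y => ?_)
  have h1 := le_mixDensity (h := h) (π := π) hμ hQ y.1 y.2
  rw [norm_mul, norm_inv, Real.norm_eq_abs, Real.norm_of_nonneg (hμ0.le.trans h1)]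
  exact mul_le_mul (hC y) (inv_anti₀ hμ0 h1) (inv_nonneg.2 (hμ0.le.trans h1))
    ((abs_nonneg _).trans (hC y))

/-- Exploration keeps the density above `μ`, so `C/μ` dominates uniformly in `Q`. This serves both
the existence of optimizers and the limit in the first-order condition. -/
lemma continuousOn_integral_div_mixDensity (DX : Measure X) [IsFiniteMeasure DX] (hμ0 : 0 < μ)
    (hμ : μ ≤ 1) (hπ : ∀ p, Measurable (π p)) {g : X × I → ℝ} (hg : Measurable g) {C : ℝ}
    (hC : ∀ y, |g y| ≤ C) :
    ContinuousOn (fun Q => ∫ y, g y * (mixDensity h μ π Q y.1 y.2)⁻¹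
      ∂(DX.prod (volume : Measure I))) (stdSimplex ℝ P) := by
  refine continuousOn_of_dominated (bound := fun _ => C * μ⁻¹) (fun Q _ => ?_) (fun Q hQ => ?_)
    (integrable_const _) ?_
  · exact (hg.mul (measurable_mixDensity hπ Q).inv).aestronglyMeasurable
  · refine Filter.Eventually.of_forall fun y => ?_
    have h1 := le_mixDensity (h := h) (π := π) hμ hQ.1 y.1 y.2
    rw [norm_mul, norm_inv, Real.norm_eq_abs, Real.norm_of_nonneg (hμ0.le.trans h1)]
    exact mul_le_mul (hC y) (inv_anti₀ hμ0 h1) (inv_nonneg.2 (hμ0.le.trans h1))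
      ((abs_nonneg _).trans (hC y))
  · refine Filter.Eventually.of_forall fun y => ?_
    refine continuousOn_const.mul ((continuous_mixDensity h μ π y.1 y.2).continuousOn.inv₀ ?_)
    intro Q hQ
    exact (hμ0.trans_le (le_mixDensity hμ hQ.1 y.1 y.2)).ne'

lemma integral_inv_mixDensity_smooth (DX : Measure X) [IsFiniteMeasure DX] (hh : 0 < h)
    (hμ0 : 0 < μ) (hμ : μ ≤ 1) (hπ : ∀ p, Measurable (π p)) {Q : P → ℝ} (hQ : ∀ p, 0 ≤ Q p)
    (p : P) :
    ∫ x, ∫ a, (mixDensity h μ π Q x a)⁻¹ ∂(smooth h (π p x)) ∂DX =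
      ∫ y, smoothDensity h (π p y.1) y.2 * (mixDensity h μ π Q y.1 y.2)⁻¹
        ∂(DX.prod (volume : Measure I)) := by
  rw [integral_prod _ (integrable_div_mixDensity DX hμ0 hμ hπ hQ
    (measurable_smoothDensity_comp (hπ p)) (C := (min h 1)⁻¹) fun y => by
      rw [abs_of_nonneg (smoothDensity_nonneg _ _ _)]; exact smoothDensity_le hh _ _)]
  simp_rw [integral_smooth]

lemma isCompact_distributions (S : Finset P) : IsCompact (distributions S) := by
  refine (isCompact_stdSimplex (𝕜 := ℝ) (ι := P)).inter_right (t := {Q | ∀ p ∉ S, Q p = 0}) ?_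
  simp only [Set.ofPred_forall]
  exact isClosed_iInter fun p => isClosed_iInter fun _ =>
    isClosed_eq (continuous_apply p) continuous_const

open Classical in
lemma single_mem_distributions {S : Finset P} {p : P} (hp : p ∈ S) :
    (Pi.single p 1 : P → ℝ) ∈ distributions S := by
  refine ⟨single_mem_stdSimplex ℝ p, fun p' hp' => ?_⟩
  refine Pi.single_eq_of_ne (fun h => hp' ?_) _
  rwa [h]

lemma distributions_nonempty {S : Finset P} (hS : S.Nonempty) : (distributions S).Nonempty := by
  classical
  exact ⟨_, single_mem_distributions hS.choose_spec⟩

lemma continuousOn_objective (DX : Measure X) [IsFiniteMeasure DX] (hh : 0 < h)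
    (hμ0 : 0 < μ) (hμ : μ ≤ 1) (hπ : ∀ p, Measurable (π p)) {S : Finset P} (hS : S.Nonempty) :
    ContinuousOn (objective DX h μ π S) (distributions S) := by
  have hne : Nonempty S := hS.to_subtype
  -- The supremum runs over a finite nonempty set, so it inherits continuity from its members.
  have h1 : ∀ Q, objective DX h μ π S Q = Finset.univ.sup' Finset.univ_nonempty fun p : S =>
      ∫ x, ∫ a, (mixDensity h μ π Q x a)⁻¹ ∂(smooth h (π p x)) ∂DX := by
    intro Q
    rw [Finset.sup'_univ_eq_ciSup]
    rfl
  refine ContinuousOn.congr (ContinuousOn.finset_sup'_apply _ fun p _ => ?_) fun Q _ => h1 Q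
  refine ((continuousOn_integral_div_mixDensity (h := h) DX hμ0 hμ hπ
    (measurable_smoothDensity_comp (hπ p)) (C := (min h 1)⁻¹) fun y => by
      rw [abs_of_nonneg (smoothDensity_nonneg _ _ _)]; exact smoothDensity_le hh _ _).mono
        fun Q hQ => hQ.1).congr fun Q hQ => ?_
  exact integral_inv_mixDensity_smooth DX hh hμ0 hμ hπ hQ.1.1 p

lemma exists_isOptimizer (DX : Measure X) [IsFiniteMeasure DX] (hh : 0 < h)
    (hπ : ∀ p, Measurable (π p)) : ∃ Q, IsOptimizer DX h π Q := by
  have h1 : ∀ (k : ℕ) (S : Finset P), ∃ Q : P → ℝ, S.Nonempty → Q ∈ distributions S ∧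
      IsMinOn (objective DX h (exploreProb k) π S) (distributions S) Q := by
    intro k S
    by_cases hS : S.Nonempty
    · obtain ⟨Q, hQ, hQ'⟩ := (isCompact_distributions S).exists_isMinOn
        (distributions_nonempty hS) (continuousOn_objective DX hh (exploreProb_pos k)
          ((exploreProb_le_half k).trans (by norm_num)) hπ hS)
      exact ⟨Q, fun _ => ⟨hQ, hQ'⟩⟩
    · exact ⟨0, fun h => absurd h hS⟩
  choose Q hQ using h1
  exact ⟨Q, hQ⟩

/-! ### The characteristic volume and the variance constraint. -/

/-- The pairs of a context and an action close to the choice of some policy in `S`. -/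
def coveredSet (h : ℝ) (π : P → X → I) (S : Finset P) : Set (X × I) :=
  {y | y.2 ∈ ⋃ p ∈ S, Metric.closedBall (π p y.1) h}

lemma measurableSet_coveredSet (hπ : ∀ p, Measurable (π p)) (S : Finset P) :
    MeasurableSet (coveredSet h π S) := by
  have : coveredSet h π S = ⋃ p ∈ S, {y : X × I | dist y.2 (π p y.1) ≤ h} := by
    ext y; simp [coveredSet]
  rw [this]
  refine Finset.measurableSet_biUnion _ fun p _ => ?_
  have h1 : Measurable fun y : X × I => (π p y.1, y.2) :=
    ((hπ p).comp measurable_fst).prodMk measurable_snd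
  exact h1 (measurableSet_dist_le h)

lemma charVolume_eq (DX : Measure X) [IsFiniteMeasure DX] (hπ : ∀ p, Measurable (π p))
    (S : Finset P) :
    charVolume DX h π S = (DX.prod (volume : Measure I)).real (coveredSet h π S) := by
  have h1 := measurable_measure_prodMk_left (ν := (volume : Measure I))
    (measurableSet_coveredSet (h := h) hπ S)
  rw [measureReal_def, Measure.prod_apply (measurableSet_coveredSet hπ S),
    ← integral_toReal h1.aemeasurable
      (Filter.Eventually.of_forall fun x => measure_lt_top _ _)]
  rfl

lemma charVolume_le_one (DX : Measure X) [IsProbabilityMeasure DX] (hπ : ∀ p, Measurable (π p))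
    (S : Finset P) : charVolume DX h π S ≤ 1 := by
  rw [charVolume_eq DX hπ]
  exact measureReal_le_one

/-- The ball of a single policy already has this measure. The bound serves to make the volume, and
with it every batch size, positive. -/
lemma min_le_charVolume (DX : Measure X) [IsProbabilityMeasure DX] (hh : 0 < h)
    (hπ : ∀ p, Measurable (π p)) {S : Finset P} (hS : S.Nonempty) :
    min h 1 ≤ charVolume DX h π S := by
  obtain ⟨p, hp⟩ := hS
  have h1 : ∀ x, min h 1 ≤ volume.real (⋃ p ∈ S, Metric.closedBall (π p x) h) := fun x =>
    (min_le_volume_closedBall hh (π p x)).trans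
      (measureReal_mono (Set.subset_biUnion_of_mem (u := fun p => Metric.closedBall (π p x) h)
        (Finset.mem_coe.2 hp)) (measure_ne_top _ _))
  have hm : Measurable fun x => volume.real (⋃ p ∈ S, Metric.closedBall (π p x) h) :=
    (measurable_measure_prodMk_left (ν := (volume : Measure I))
      (measurableSet_coveredSet (h := h) hπ S)).ennreal_toReal
  have h2 := integral_mono (μ := DX) (integrable_const (min h 1))
    (Integrable.of_bound hm.aestronglyMeasurable (C := 1)
      (Filter.Eventually.of_forall fun x => by
        rw [Real.norm_of_nonneg measureReal_nonneg]; exact measureReal_le_one)) h1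
  rw [integral_const, probReal_univ, one_smul] at h2
  exact h2

lemma abs_log_mixDensity_le (hh : 0 < h) (hμ0 : 0 < μ) (hμ : μ ≤ 1) {Q : P → ℝ}
    (hQ : Q ∈ stdSimplex ℝ P) (x : X) (a : I) :
    |Real.log (mixDensity h μ π Q x a)| ≤ |Real.log μ| + |Real.log (min h 1)⁻¹| := by
  have h1 := le_mixDensity (h := h) (π := π) hμ hQ.1 x a
  have h2 := mixDensity_le hh hμ0.le hμ π hQ x a
  have h3 := Real.log_le_log hμ0 h1
  have h4 := Real.log_le_log (hμ0.trans_le h1) h2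
  rw [abs_le]
  constructor
  · linarith [neg_abs_le (Real.log μ), abs_nonneg (Real.log (min h 1)⁻¹)]
  · linarith [le_abs_self (Real.log (min h 1)⁻¹), abs_nonneg (Real.log μ)]

lemma continuousOn_log_potential (DX : Measure X) [IsFiniteMeasure DX] (hh : 0 < h)
    (hμ0 : 0 < μ) (hμ : μ ≤ 1) (hπ : ∀ p, Measurable (π p)) (S : Finset P) :
    ContinuousOn (fun Q => ∫ y in coveredSet h π S, Real.log (mixDensity h μ π Q y.1 y.2)
      ∂(DX.prod (volume : Measure I))) (stdSimplex ℝ P) := by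
  refine continuousOn_of_dominated
    (bound := fun _ => |Real.log μ| + |Real.log (min h 1)⁻¹|) (fun Q _ => ?_) (fun Q hQ => ?_)
    (integrable_const _) ?_
  · exact (measurable_mixDensity hπ Q).log.aestronglyMeasurable
  · exact Filter.Eventually.of_forall fun y => abs_log_mixDensity_le hh hμ0 hμ hQ _ _
  · refine Filter.Eventually.of_forall fun y => ?_
    refine (continuous_mixDensity h μ π y.1 y.2).continuousOn.log ?_
    intro Q hQ
    exact (hμ0.trans_le (le_mixDensity hμ hQ.1 y.1 y.2)).ne'

/-- A distribution that maximizes the expected logarithm of the action density over the covered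
set satisfies the variance constraint for every policy in `S`. -/
lemma exists_integral_div_mixDensity_le (DX : Measure X) [IsProbabilityMeasure DX] (hh : 0 < h)
    (hμ0 : 0 < μ) (hμ : μ ≤ 1 / 2) (hπ : ∀ p, Measurable (π p)) {S : Finset P}
    (hS : S.Nonempty) :
    ∃ Q ∈ distributions S, ∀ p ∈ S,
      ∫ y, smoothDensity h (π p y.1) y.2 * (mixDensity h μ π Q y.1 y.2)⁻¹
        ∂(DX.prod (volume : Measure I)) ≤ 2 * charVolume DX h π S := by
  classical
  have hμ1 : μ ≤ 1 := hμ.trans (by norm_num)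
  set m := DX.prod (volume : Measure I) with hm
  set U := coveredSet h π S with hU
  have hUm : MeasurableSet U := measurableSet_coveredSet hπ S
  obtain ⟨Q, hQ, hQmax⟩ := (isCompact_distributions S).exists_isMaxOn (distributions_nonempty hS)
    ((continuousOn_log_potential DX hh hμ0 hμ1 hπ S).mono fun Q hQ => hQ.1)
  refine ⟨Q, hQ, fun p hp => ?_⟩
  set G : P → X × I → ℝ := fun p y => smoothDensity h (π p y.1) y.2 with hG
  have hGm : ∀ p, Measurable (G p) := fun p => measurable_smoothDensity_comp (hπ p)
  have hG0 : ∀ p y, 0 ≤ G p y := fun p y => smoothDensity_nonneg _ _ _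
  have hGb : ∀ p y, |G p y| ≤ (min h 1)⁻¹ := fun p y => by
    rw [abs_of_nonneg (hG0 p y)]; exact smoothDensity_le hh _ _
  set GQ : X × I → ℝ := fun y => ∑ p, Q p * G p y with hGQ
  have hGQm : Measurable GQ := Finset.measurable_fun_sum _ fun p _ => (hGm p).const_mul _
  have hGQ0 : ∀ y, 0 ≤ GQ y := fun y =>
    Finset.sum_nonneg fun p _ => mul_nonneg (hQ.1.1 p) (hG0 p y)
  have hGQb : ∀ y, GQ y ≤ (min h 1)⁻¹ := by
    intro y
    calc GQ y ≤ ∑ p, Q p * (min h 1)⁻¹ := Finset.sum_le_sum fun p _ =>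
            mul_le_mul_of_nonneg_left (smoothDensity_le hh _ _) (hQ.1.1 p)
      _ = (min h 1)⁻¹ := by rw [← Finset.sum_mul, hQ.1.2, one_mul]
  -- The smoothed density of `p ∈ S` lives on `U`, so restricting to `U` loses nothing.
  have hsupp : ∀ y, U.indicator (G p) y = G p y := by
    intro y
    by_cases hy : y ∈ U
    · simp [hy]
    · rw [Set.indicator_of_notMem hy]
      symm
      refine Set.indicator_of_notMem (fun hy' => hy ?_) _
      exact Set.mem_biUnion (x := p) (Finset.mem_coe.2 hp) hy'
  set g : X × I → ℝ := U.indicator fun y => G p y - GQ y with hg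
  have hgm : Measurable g := ((hGm p).sub hGQm).indicator hUm
  have hgb : ∀ y, |g y| ≤ (min h 1)⁻¹ := by
    intro y
    have h0 : (0 : ℝ) ≤ (min h 1)⁻¹ := inv_nonneg.2 (lt_min hh one_pos).le
    by_cases hy : y ∈ U
    · rw [hg, Set.indicator_of_mem hy, abs_le]
      have := (abs_le.1 (hGb p y)).2
      constructor <;> linarith [hG0 p y, hGQ0 y, hGQb y]
    · rw [hg, Set.indicator_of_notMem hy, abs_zero]; exact h0
  -- The segment from the maximizer to the vertex `p`. The action density is affine along it, with
  -- slope `(1 - μ) * (G p - GQ)`.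
  set Qt : ℝ → P → ℝ := fun t => (1 - t) • Q + t • (Pi.single p 1 : P → ℝ) with hQt
  have hsingle := single_mem_distributions (P := P) hp
  have hQtS : ∀ t ∈ Set.Icc (0 : ℝ) 1, Qt t ∈ distributions S := by
    intro t ht
    refine ⟨(convex_stdSimplex ℝ P) hQ.1 hsingle.1 (by linarith [ht.2]) ht.1 (by ring), ?_⟩
    intro p' hp'
    simp [hQt, hQ.2 p' hp', show (Pi.single p 1 : P → ℝ) p' = 0 from hsingle.2 p' hp']
  have hmix : ∀ t y, mixDensity h μ π (Qt t) y.1 y.2 =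
      mixDensity h μ π Q y.1 y.2 + t * (1 - μ) * (G p y - GQ y) := by
    intro t y
    have : ∑ p', Qt t p' * G p' y = (1 - t) * GQ y + t * G p y := by
      simp only [hQt, Pi.add_apply, Pi.smul_apply, smul_eq_mul, add_mul, Finset.sum_add_distrib,
        hGQ, Finset.mul_sum, mul_assoc]
      congr 1
      simp [Pi.single_apply]
    have h1 : mixDensity h μ π (Qt t) y.1 y.2 = μ + (1 - μ) * ∑ p', Qt t p' * G p' y := rfl
    have h2 : mixDensity h μ π Q y.1 y.2 = μ + (1 - μ) * GQ y := rfl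
    rw [h1, h2, this]
    ring
  have hlogint : ∀ Q' ∈ distributions S, Integrable
      (fun y : X × I => Real.log (mixDensity h μ π Q' y.1 y.2)) (m.restrict U) := by
    intro Q' hQ'
    exact Integrable.of_bound (measurable_mixDensity hπ Q').log.aestronglyMeasurable
      (|Real.log μ| + |Real.log (min h 1)⁻¹|)
      (Filter.Eventually.of_forall fun y => abs_log_mixDensity_le hh hμ0 hμ1 hQ'.1 _ _)
  -- First-order condition without differentiation. With `q_t` the density of `Qt t` and `q` that of
  -- `Q`, `t(1-μ)(G p - GQ)/q_t = 1 - q/q_t ≤ log q_t - log q`, and the right side has integral at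
  -- most zero over `U` by maximality.
  have hneg : ∀ t ∈ Set.Ioc (0 : ℝ) 1,
      ∫ y, g y * (mixDensity h μ π (Qt t) y.1 y.2)⁻¹ ∂m ≤ 0 := by
    intro t ht
    have htS := hQtS t ⟨ht.1.le, ht.2⟩
    have hind : ∀ y, g y * (mixDensity h μ π (Qt t) y.1 y.2)⁻¹ =
        U.indicator (fun y => (G p y - GQ y) * (mixDensity h μ π (Qt t) y.1 y.2)⁻¹) y := by
      intro y
      by_cases hy : y ∈ U <;> simp [hg, hy]
    have hint := integrable_div_mixDensity (h := h) DX hμ0 hμ1 hπ htS.1.1 hgm hgb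
    simp_rw [hind] at hint ⊢
    rw [integrable_indicator_iff hUm] at hint
    rw [integral_indicator hUm]
    have h1 : ∫ y in U, t * (1 - μ) * ((G p y - GQ y) * (mixDensity h μ π (Qt t) y.1 y.2)⁻¹) ∂m ≤
        ∫ y in U, (Real.log (mixDensity h μ π (Qt t) y.1 y.2) -
          Real.log (mixDensity h μ π Q y.1 y.2)) ∂m := by
      refine integral_mono (Integrable.const_mul hint _)
        ((hlogint _ htS).sub (hlogint _ hQ)) fun y => ?_
      have hq1 := hμ0.trans_le (le_mixDensity (h := h) (π := π) hμ1 htS.1.1 y.1 y.2)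
      have hq2 := hμ0.trans_le (le_mixDensity (h := h) (π := π) hμ1 hQ.1.1 y.1 y.2)
      have := Real.one_sub_inv_le_log_of_pos (div_pos hq1 hq2)
      rw [Real.log_div hq1.ne' hq2.ne', inv_div] at this
      refine le_trans (le_of_eq ?_) this
      rw [eq_sub_iff_add_eq, ← mul_assoc, ← div_eq_mul_inv, ← add_div, add_comm, ← hmix t y,
        div_self hq1.ne']
    rw [integral_const_mul, integral_sub (hlogint _ htS) (hlogint _ hQ)] at h1
    have h2 : ∫ y in U, Real.log (mixDensity h μ π (Qt t) y.1 y.2) ∂m ≤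
        ∫ y in U, Real.log (mixDensity h μ π Q y.1 y.2) ∂m := hQmax htS
    by_contra hcon
    push Not at hcon
    have := mul_pos (mul_pos ht.1 (by linarith : 0 < 1 - μ)) hcon
    linarith
  -- Let `t` tend to zero from the right.
  have hlim : ∫ y, g y * (mixDensity h μ π Q y.1 y.2)⁻¹ ∂m ≤ 0 := by
    have hc := continuousOn_integral_div_mixDensity (h := h) DX hμ0 hμ1 hπ hgm hgb Q hQ.1
    have hQ0 : Qt 0 = Q := by simp [hQt]
    have hcQt : Continuous Qt := by fun_prop
    have ht : Filter.Tendsto Qt (nhdsWithin 0 (Set.Ioc 0 1)) (nhdsWithin Q (stdSimplex ℝ P)) := by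
      refine tendsto_nhdsWithin_iff.2 ⟨?_, ?_⟩
      · have := hcQt.tendsto 0
        rw [hQ0] at this
        exact this.mono_left nhdsWithin_le_nhds
      · filter_upwards [self_mem_nhdsWithin] with t ht
        exact (hQtS t ⟨ht.1.le, ht.2⟩).1
    have hne : (nhdsWithin (0 : ℝ) (Set.Ioc 0 1)).NeBot := by
      rw [nhdsWithin_Ioc_eq_nhdsGT one_pos]; infer_instance
    refine le_of_tendsto (hc.tendsto.comp ht) ?_
    filter_upwards [self_mem_nhdsWithin] with t ht
    exact hneg t ht
  have hi1 := integrable_div_mixDensity (h := h) DX hμ0 hμ1 hπ hQ.1.1 (hGm p) (hGb p)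
  have hi2 := integrable_div_mixDensity (h := h) DX hμ0 hμ1 hπ hQ.1.1 hgm hgb
  have hi3 : Integrable (U.indicator fun _ => (2 : ℝ)) m :=
    (integrable_const (2 : ℝ)).indicator hUm
  have hfin : ∫ y, G p y * (mixDensity h μ π Q y.1 y.2)⁻¹ ∂m ≤
      ∫ y, (g y * (mixDensity h μ π Q y.1 y.2)⁻¹ + U.indicator (fun _ => (2 : ℝ)) y) ∂m := by
    refine integral_mono hi1 (hi2.add hi3) fun y => ?_
    have hq := hμ0.trans_le (le_mixDensity (h := h) (π := π) hμ1 hQ.1.1 y.1 y.2)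
    have hq2 : mixDensity h μ π Q y.1 y.2 = μ + (1 - μ) * GQ y := rfl
    change G p y * (mixDensity h μ π Q y.1 y.2)⁻¹ ≤
      g y * (mixDensity h μ π Q y.1 y.2)⁻¹ + U.indicator (fun _ => (2 : ℝ)) y
    by_cases hy : y ∈ U
    · rw [hg, Set.indicator_of_mem hy, Set.indicator_of_mem hy, sub_mul]
      -- The density is at least `(1 - μ) * GQ`, and `μ ≤ 1/2`.
      have : GQ y * (mixDensity h μ π Q y.1 y.2)⁻¹ ≤ 2 := by
        rw [← div_eq_mul_inv, div_le_iff₀ hq, hq2]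
        nlinarith [hGQ0 y]
      linarith
    · have := hsupp y
      rw [Set.indicator_of_notMem hy] at this
      rw [← this, hg, Set.indicator_of_notMem hy, Set.indicator_of_notMem hy]
      simp
  refine hfin.trans ?_
  rw [integral_add hi2 hi3, integral_indicator hUm, setIntegral_const, charVolume_eq DX hπ,
    smul_eq_mul]
  linarith [mul_comm (m.real U) 2]

/-- The variance constraint for the solutions of the optimization problem. -/
lemma IsOptimizer.integral_div_mixDensity_le {DX : Measure X} [IsProbabilityMeasure DX]
    (hh : 0 < h) (hπ : ∀ p, Measurable (π p)) {Q : ℕ → Finset P → P → ℝ}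
    (hQ : IsOptimizer DX h π Q) (k : ℕ) {S : Finset P} {p : P} (hp : p ∈ S) :
    ∫ y, smoothDensity h (π p y.1) y.2 * (mixDensity h (exploreProb k) π (Q k S) y.1 y.2)⁻¹
      ∂(DX.prod (volume : Measure I)) ≤ 2 * charVolume DX h π S := by
  have hS : S.Nonempty := ⟨p, hp⟩
  have hμ1 : exploreProb k ≤ 1 := (exploreProb_le_half k).trans (by norm_num)
  obtain ⟨hQ1, hQ2⟩ := hQ k S hS
  obtain ⟨Q', hQ', hb⟩ := exists_integral_div_mixDensity_le DX hh (exploreProb_pos k)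
    (exploreProb_le_half k) hπ hS
  have hne : Nonempty S := hS.to_subtype
  rw [← integral_inv_mixDensity_smooth DX hh (exploreProb_pos k) hμ1 hπ hQ1.1.1 p]
  calc _ ≤ objective DX h (exploreProb k) π S (Q k S) :=
        le_ciSup (f := fun p : S => ∫ x, ∫ a, (mixDensity h (exploreProb k) π (Q k S) x a)⁻¹
          ∂(smooth h (π p x)) ∂DX) (Set.finite_range _).bddAbove ⟨p, hp⟩
    _ ≤ objective DX h (exploreProb k) π S Q' := hQ2 hQ'
    _ ≤ 2 * charVolume DX h π S := by
        refine ciSup_le fun p' => ?_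
        rw [integral_inv_mixDensity_smooth DX hh (exploreProb_pos k) hμ1 hπ hQ'.1.1 p']
        exact hb p' p'.2

end Optimizer

/-! ### The median -/

/-- Data-dependent discrete choices (a sorting permutation, an epoch index, an epoch state) take
countably many values, so measurability can be checked with the choice frozen. -/
lemma measurable_of_countable_cases {α δ ι : Type*} [Countable ι] [MeasurableSpace α]
    [MeasurableSpace δ] {c : α → ι} (hc : ∀ i, MeasurableSet {a | c a = i}) {F : ι → α → δ}
    (hF : ∀ i, Measurable (F i)) : Measurable fun a => F (c a) a := by
  intro s hs
  have : (fun a => F (c a) a) ⁻¹' s = ⋃ i, {a | c a = i} ∩ F i ⁻¹' s := by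
    ext a; simp
  rw [this]
  exact MeasurableSet.iUnion fun i => (hc i).inter (hF i hs)

lemma measurableSet_forall {α ι : Type*} [Countable ι] [MeasurableSpace α] {p : ι → α → Prop}
    (hp : ∀ i, MeasurableSet {a | p i a}) : MeasurableSet {a | ∀ i, p i a} := by
  rw [Set.ofPred_forall]
  exact MeasurableSet.iInter hp

lemma measurable_apply_sort {n : ℕ} (i : Fin n) :
    Measurable fun f : Fin n → ℝ => f (Tuple.sort f i) := by
  refine measurable_of_countable_cases (c := fun f : Fin n → ℝ => Tuple.sort f)
    (F := fun τ f => f (τ i)) (fun τ => ?_) fun τ => measurable_pi_apply _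
  -- The stable sorting permutation is characterized by finitely many comparisons, with ties broken
  -- by index.
  have : {f : Fin n → ℝ | Tuple.sort f = τ} = {f : Fin n → ℝ |
      (∀ i j, i ≤ j → f (τ i) ≤ f (τ j)) ∧
        ∀ i j, i < j → f (τ i) = f (τ j) → τ i < τ j} := by
    ext f
    change Tuple.sort f = τ ↔ _
    rw [eq_comm, Tuple.eq_sort_iff]
    rfl
  rw [this]
  have hm : ∀ j : Fin n, Measurable fun f : Fin n → ℝ => f j := fun j => measurable_pi_apply j
  refine MeasurableSet.inter ?_ ?_
  · refine measurableSet_forall fun i => measurableSet_forall fun j => ?_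
    exact (MeasurableSet.const _).imp (measurableSet_le (hm _) (hm _))
  · refine measurableSet_forall fun i => measurableSet_forall fun j => ?_
    exact (MeasurableSet.const _).imp
      ((measurableSet_eq_fun (hm _) (hm _)).imp (MeasurableSet.const _))

lemma measurable_median {n : ℕ} : Measurable fun f : Fin n → ℝ => median f := by
  unfold median
  split_ifs
  · exact ((measurable_apply_sort _).add (measurable_apply_sort _)).div_const 2
  · exact measurable_const

/-- If the median is off by more than `r`, then so are at least half of the values. -/
lemma le_two_mul_card_of_lt_abs_median_sub {n : ℕ} {f : Fin n → ℝ} {c r : ℝ}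
    (h : r < |median f - c|) :
    n ≤ 2 * (Finset.univ.filter fun j => r < |f j - c|).card := by
  classical
  rcases Nat.eq_zero_or_pos n with rfl | hn
  · simp
  have hmono := Tuple.monotone_sort f
  have hlo : (⟨(n - 1) / 2, by omega⟩ : Fin n) ≤ ⟨n / 2, by omega⟩ := by
    simp only [Fin.mk_le_mk]; omega
  have hle := hmono hlo
  simp only [Function.comp_apply] at hle
  have hmed : median f = (f (Tuple.sort f ⟨(n - 1) / 2, by omega⟩) +
      f (Tuple.sort f ⟨n / 2, by omega⟩)) / 2 := by
    simp [median, hn]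
  have hcard : ∀ A : Finset (Fin n), (∀ j ∈ A, r < |f (Tuple.sort f j) - c|) →
      A.card ≤ (Finset.univ.filter fun j => r < |f j - c|).card := by
    intro A hA
    rw [← Finset.card_map (Tuple.sort f).toEmbedding]
    refine Finset.card_le_card fun j hj => ?_
    obtain ⟨i, hi, rfl⟩ := Finset.mem_map.1 hj
    exact Finset.mem_filter.2 ⟨Finset.mem_univ _, hA i hi⟩
  -- If the median is too large, so is the upper of the two middle values and everything after it;
  -- if it is too small, so is the lower one and everything before it. Either tail contains at least
  -- half of the indices, for both parities of `n`.
  rcases lt_abs.1 h with h1 | h1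
  · have h2 : c + r < f (Tuple.sort f ⟨n / 2, by omega⟩) := by rw [hmed] at h1; linarith
    have := hcard (Finset.Ici ⟨n / 2, by omega⟩) fun j hj => by
      have := hmono (Finset.mem_Ici.1 hj)
      simp only [Function.comp_apply] at this
      exact lt_abs.2 (Or.inl (by linarith))
    rw [Fin.card_Ici] at this
    simp only at this
    omega
  · have h2 : f (Tuple.sort f ⟨(n - 1) / 2, by omega⟩) < c - r := by rw [hmed] at h1; linarith
    have := hcard (Finset.Iic ⟨(n - 1) / 2, by omega⟩) fun j hj => by
      have := hmono (Finset.mem_Iic.1 hj)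
      simp only [Function.comp_apply] at this
      exact lt_abs.2 (Or.inr (by linarith))
    rw [Fin.card_Iic] at this
    simp only at this
    omega

/-! ### The epochs -/

section Epochs

variable [Fintype P] [MeasurableSpace X]

/-- The estimate of the loss of `p` at the end of an epoch that begins in round `w.1` with the
version space `w.2`. -/
def epochEstimate (DX : Measure X) (h : ℝ) (π : P → X → I) (T : ℕ) (Q : ℕ → Finset P → P → ℝ)
    {t : ℕ} (z : Fin t → X × I × ℝ) (k : ℕ) (w : ℕ × Finset P) (p : P) : ℝ :=
  median fun i : Fin (numBatches T (Fintype.card P)) =>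
    batchEstimate h (exploreProb k) π (Q k w.2) w.1 (batchSize DX h π k w.2) z i p

/-- The number of rounds of an epoch. -/
def epochLength (DX : Measure X) (h : ℝ) (π : P → X → I) (T : ℕ) (k : ℕ) (S : Finset P) : ℕ :=
  batchSize DX h π k S * numBatches T (Fintype.card P)

variable {DX : Measure X} {h : ℝ} {π : P → X → I} {T : ℕ} {Q : ℕ → Finset P → P → ℝ}

lemma epochState_succ_fst {t : ℕ} (z : Fin t → X × I × ℝ) (k : ℕ) :
    (epochState DX h π T Q z (k + 1)).1 = (epochState DX h π T Q z k).1 +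
      epochLength DX h π T k (epochState DX h π T Q z k).2 := rfl

lemma mem_epochState_succ_snd {t : ℕ} {z : Fin t → X × I × ℝ} {k : ℕ} {p : P} :
    p ∈ (epochState DX h π T Q z (k + 1)).2 ↔ p ∈ (epochState DX h π T Q z k).2 ∧
      ∀ p' ∈ (epochState DX h π T Q z k).2,
        epochEstimate DX h π T Q z k (epochState DX h π T Q z k) p ≤
          epochEstimate DX h π T Q z k (epochState DX h π T Q z k) p' + 3 * radius k := by
  simp only [epochState, epochEstimate, Finset.mem_filter]

lemma epochState_nonempty [Nonempty P] {t : ℕ} (z : Fin t → X × I × ℝ) (k : ℕ) :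
    (epochState DX h π T Q z k).2.Nonempty := by
  induction k with
  | zero => exact Finset.univ_nonempty
  | succ k ih =>
    obtain ⟨p, hp, hmin⟩ := Finset.exists_min_image _
      (epochEstimate DX h π T Q z k (epochState DX h π T Q z k)) ih
    refine ⟨p, mem_epochState_succ_snd.2 ⟨hp, fun p' hp' => ?_⟩⟩
    linarith [hmin p' hp', radius_pos k]

lemma four_le_mul_and_mul_le_mul_logb {T N : ℕ} (hT : 2 ≤ T) (hN : 2 ≤ N) :
    (4 : ℝ) ≤ T * N ∧ (T * N : ℝ) ≤ T * N * Real.logb 2 T := by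
  have h1 : (2 : ℝ) ≤ T := by exact_mod_cast hT
  have h2 : (2 : ℝ) ≤ N := by exact_mod_cast hN
  have h3 : (1 : ℝ) ≤ Real.logb 2 T := by
    rw [Real.le_logb_iff_rpow_le (by norm_num) (by linarith)]
    simpa using h1
  have h4 : (4 : ℝ) ≤ T * N := by nlinarith
  exact ⟨h4, le_mul_of_one_le_right (by linarith) h3⟩

lemma numBatches_pos {T N : ℕ} (hT : 2 ≤ T) (hN : 2 ≤ N) : 0 < numBatches T N := by
  obtain ⟨h1, h2⟩ := four_le_mul_and_mul_le_mul_logb hT hN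
  unfold numBatches
  have : 0 < ⌈Real.log (T * N * Real.logb 2 T)⌉₊ := Nat.ceil_pos.2 (Real.log_pos (by linarith))
  omega

lemma le_batchSize (DX : Measure X) (h : ℝ) (π : P → X → I) (k : ℕ) (S : Finset P) :
    320 * charVolume DX h π S / (radius k ^ 2 * h) ≤ batchSize DX h π k S :=
  Nat.le_ceil _

lemma batchSize_pos [IsProbabilityMeasure DX] (hh : 0 < h) (hπ : ∀ p, Measurable (π p)) (k : ℕ)
    {S : Finset P} (hS : S.Nonempty) : 0 < batchSize DX h π k S := by
  have := (lt_min hh one_pos).trans_le (min_le_charVolume DX hh hπ hS)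
  have := radius_pos k
  exact Nat.ceil_pos.2 (by positivity)

lemma epochLength_pos [IsProbabilityMeasure DX] (hh : 0 < h) (hπ : ∀ p, Measurable (π p))
    (hT : 2 ≤ T) (hP : 2 ≤ Fintype.card P) (k : ℕ) {S : Finset P} (hS : S.Nonempty) :
    0 < epochLength DX h π T k S :=
  Nat.mul_pos (batchSize_pos hh hπ k hS) (numBatches_pos hT hP)

/-- No epoch is empty. In particular epoch `k` starts no earlier than round `k`, so the search bound
`t` in the definition of the current epoch excludes nothing. -/
lemma epochState_fst_strictMono [IsProbabilityMeasure DX] (hh : 0 < h)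
    (hπ : ∀ p, Measurable (π p)) (hT : 2 ≤ T) (hP : 2 ≤ Fintype.card P) {t : ℕ}
    (z : Fin t → X × I × ℝ) : StrictMono fun k => (epochState DX h π T Q z k).1 := by
  have : Nonempty P := Fintype.card_pos_iff.1 (by omega)
  refine strictMono_nat_of_lt_succ fun k => ?_
  have := epochLength_pos (DX := DX) hh hπ hT hP k
    (epochState_nonempty (DX := DX) (h := h) (π := π) (T := T) (Q := Q) z k)
  rw [epochState_succ_fst]
  omega

/-! ### Causality: an epoch depends only on the rounds before it. -/

/-- The observations of the first `t` rounds. -/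
def takeRounds {α : Type*} {t T : ℕ} (htT : t ≤ T) (z : Fin T → α) : Fin t → α :=
  fun s => z (Fin.castLE htT s)

lemma batchEstimate_takeRounds {μ : ℝ} {Q : P → ℝ} {start n t t' : ℕ} (htt' : t ≤ t')
    (z : Fin t' → X × I × ℝ) (i : ℕ) (p : P) (hi : start + (i + 1) * n ≤ t) :
    batchEstimate h μ π Q start n (takeRounds htt' z) i p =
      batchEstimate h μ π Q start n z i p := by
  unfold batchEstimate
  congr 1
  refine Finset.sum_bij (fun s _ => Fin.castLE htt' s) ?_ ?_ ?_ ?_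
  · intro s hs
    simpa using hs
  · intro s _ s' _ hss'
    exact Fin.castLE_injective htt' hss'
  · intro s hs
    simp only [Finset.mem_filter, Finset.mem_univ, true_and] at hs
    exact ⟨⟨s, by omega⟩, by simpa using hs, rfl⟩
  · intro s _
    rfl

lemma epochEstimate_takeRounds {t t' : ℕ} (htt' : t ≤ t') (z : Fin t' → X × I × ℝ) (k : ℕ)
    (w : ℕ × Finset P) (p : P) (hw : w.1 + epochLength DX h π T k w.2 ≤ t) :
    epochEstimate DX h π T Q (takeRounds htt' z) k w p = epochEstimate DX h π T Q z k w p := by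
  unfold epochEstimate
  congr 1
  funext i
  refine batchEstimate_takeRounds htt' z i p (le_trans ?_ hw)
  unfold epochLength
  rw [mul_comm]
  gcongr
  exact i.2

/-- The estimates that define epoch `k` use only rounds before its start. The start may be known to
be at most `t` for either data sequence: the induction first shows that the preceding states agree,
after which the two alternatives coincide. -/
lemma epochState_takeRounds_or {t t' : ℕ} (htt' : t ≤ t') (z : Fin t' → X × I × ℝ) (k : ℕ)
    (hk : (epochState DX h π T Q z k).1 ≤ t ∨
      (epochState DX h π T Q (takeRounds htt' z) k).1 ≤ t) :
    epochState DX h π T Q (takeRounds htt' z) k = epochState DX h π T Q z k := by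
  induction k with
  | zero => rfl
  | succ k ih =>
    simp only [epochState_succ_fst] at hk
    have ih' := ih (hk.imp (fun h => by omega) fun h => by omega)
    rw [ih', or_self] at hk
    refine Prod.ext ?_ ?_
    · simp only [epochState_succ_fst, ih']
    · ext p
      rw [mem_epochState_succ_snd, mem_epochState_succ_snd, ih']
      simp only [epochEstimate_takeRounds htt' z k _ _ hk]

/-- Makes `epochState = w` an event of the first `w.1` rounds. -/
lemma epochState_takeRounds_eq_iff {t t' : ℕ} (htt' : t ≤ t') (z : Fin t' → X × I × ℝ) (k : ℕ)
    {w : ℕ × Finset P} (hw : w.1 ≤ t) :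
    epochState DX h π T Q (takeRounds htt' z) k = w ↔ epochState DX h π T Q z k = w := by
  constructor
  · intro h1
    rw [← h1]
    exact (epochState_takeRounds_or htt' z k (Or.inr (h1 ▸ hw))).symm
  · intro h1
    rw [← h1]
    exact epochState_takeRounds_or htt' z k (Or.inl (h1 ▸ hw))

/-! ### Measurability of the epoch states and of the algorithm. -/

lemma measurable_batchEstimate {μ : ℝ} {Q : P → ℝ} (hπ : ∀ p, Measurable (π p))
    (start n t i : ℕ) (p : P) :
    Measurable fun z : Fin t → X × I × ℝ => batchEstimate h μ π Q start n z i p := by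
  unfold batchEstimate
  refine Measurable.div_const (Finset.measurable_fun_sum _ fun s _ => ?_) _
  have h0 : Measurable fun y : X × I × ℝ => (y.1, y.2.1) := by fun_prop
  have h1 : Measurable fun y : X × I × ℝ => smoothDensity h (π p y.1) y.2.1 :=
    (measurable_smoothDensity_comp (hπ p)).comp h0
  have h2 : Measurable fun y : X × I × ℝ => mixDensity h μ π Q y.1 y.2.1 := by
    simpa only [Function.comp_def] using (measurable_mixDensity (h := h) (μ := μ) hπ Q).comp h0
  have h3 : Measurable fun y : X × I × ℝ =>
      smoothDensity h (π p y.1) y.2.1 * y.2.2 / mixDensity h μ π Q y.1 y.2.1 :=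
    (h1.mul (measurable_snd.comp measurable_snd)).div h2
  have h4 : Measurable fun z : Fin t → X × I × ℝ => z s := measurable_pi_apply s
  exact h3.comp h4

lemma measurable_epochEstimate (hπ : ∀ p, Measurable (π p)) (t k : ℕ) (w : ℕ × Finset P) (p : P) :
    Measurable fun z : Fin t → X × I × ℝ => epochEstimate DX h π T Q z k w p :=
  measurable_median.comp (measurable_pi_lambda _ fun _ => measurable_batchEstimate hπ _ _ _ _ _)

lemma measurableSet_epochState_eq (hπ : ∀ p, Measurable (π p)) (t k : ℕ) (w : ℕ × Finset P) :
    MeasurableSet {z : Fin t → X × I × ℝ | epochState DX h π T Q z k = w} := by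
  induction k generalizing w with
  | zero => exact MeasurableSet.const ((0, Finset.univ) = w)
  | succ k ih =>
    -- Split according to the previous state `v`: there are countably many, and for fixed `v` the
    -- elimination rule is a finite system of inequalities between measurable estimates.
    have : {z : Fin t → X × I × ℝ | epochState DX h π T Q z (k + 1) = w} =
        ⋃ v : ℕ × Finset P, {z | epochState DX h π T Q z k = v} ∩
          {z | v.1 + epochLength DX h π T k v.2 = w.1 ∧ ∀ p, p ∈ w.2 ↔ p ∈ v.2 ∧
            ∀ p' ∈ v.2, epochEstimate DX h π T Q z k v p ≤
              epochEstimate DX h π T Q z k v p' + 3 * radius k} := by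
      ext z
      simp only [Set.mem_iUnion, Set.mem_inter_iff]
      constructor
      · intro hz
        have hz' : epochState DX h π T Q z (k + 1) = w := hz
        refine ⟨_, rfl, ?_, fun p => ?_⟩
        · rw [← hz', epochState_succ_fst]
        · rw [← hz', mem_epochState_succ_snd]
      · rintro ⟨v, hv, h1, h2⟩
        have hv' : epochState DX h π T Q z k = v := hv
        refine Prod.ext ?_ ?_
        · rw [epochState_succ_fst, hv', h1]
        · ext p
          rw [mem_epochState_succ_snd, hv', h2]
    rw [this]
    refine MeasurableSet.iUnion fun v => (ih v).inter ?_
    refine (MeasurableSet.const _).inter (measurableSet_forall fun p => ?_)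
    refine (MeasurableSet.const _).iff ((MeasurableSet.const _).inter
      (measurableSet_forall fun p' => (MeasurableSet.const _).imp ?_))
    exact measurableSet_le (measurable_epochEstimate hπ _ _ _ _)
      ((measurable_epochEstimate hπ _ _ _ _).add measurable_const)

/-- The epoch of round `t`. -/
def currentEpoch (DX : Measure X) (h : ℝ) (π : P → X → I) (T : ℕ) (Q : ℕ → Finset P → P → ℝ)
    {t : ℕ} (z : Fin t → X × I × ℝ) : ℕ :=
  Nat.findGreatest (fun k => (epochState DX h π T Q z k).1 ≤ t) t

lemma smoothPolicyElimination_apply (t : ℕ) (z : Fin t → X × I × ℝ) (x : X) (a : I) :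
    smoothPolicyElimination DX h π T Q t z x a =
      mixDensity h (exploreProb (currentEpoch DX h π T Q z)) π
        (Q (currentEpoch DX h π T Q z)
          (epochState DX h π T Q z (currentEpoch DX h π T Q z)).2) x a := rfl

lemma currentEpoch_spec [IsProbabilityMeasure DX] (hh : 0 < h)
    (hπ : ∀ p, Measurable (π p)) (hT : 2 ≤ T) (hP : 2 ≤ Fintype.card P) {t : ℕ}
    (z : Fin t → X × I × ℝ) :
    (epochState DX h π T Q z (currentEpoch DX h π T Q z)).1 ≤ t ∧
      t < (epochState DX h π T Q z (currentEpoch DX h π T Q z + 1)).1 := by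
  constructor
  · exact Nat.findGreatest_spec (P := fun k => (epochState DX h π T Q z k).1 ≤ t)
      (Nat.zero_le t) (Nat.zero_le t)
  · by_contra hcon
    push Not at hcon
    -- If the next epoch had begun, its index would be at most its start, hence at most `t`,
    -- contradicting maximality.
    have h1 := (epochState_fst_strictMono (DX := DX) (Q := Q) hh hπ hT hP z).le_apply
      (x := currentEpoch DX h π T Q z + 1)
    exact Nat.findGreatest_is_greatest (P := fun k => (epochState DX h π T Q z k).1 ≤ t)
      (Nat.lt_succ_self _) (le_trans h1 hcon) hcon

lemma currentEpoch_eq [IsProbabilityMeasure DX] (hh : 0 < h)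
    (hπ : ∀ p, Measurable (π p)) (hT : 2 ≤ T) (hP : 2 ≤ Fintype.card P) {t : ℕ}
    {z : Fin t → X × I × ℝ} {k : ℕ} (h1 : (epochState DX h π T Q z k).1 ≤ t)
    (h2 : t < (epochState DX h π T Q z (k + 1)).1) : currentEpoch DX h π T Q z = k := by
  have hmono := epochState_fst_strictMono (DX := DX) (Q := Q) hh hπ hT hP z
  obtain ⟨h3, h4⟩ := currentEpoch_spec (DX := DX) (Q := Q) hh hπ hT hP z
  have h5 := hmono.lt_iff_lt.1 (lt_of_le_of_lt h1 h4)
  have h6 := hmono.lt_iff_lt.1 (lt_of_le_of_lt h3 h2)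
  omega

lemma measurableSet_currentEpoch_eq (hπ : ∀ p, Measurable (π p)) (t k : ℕ) :
    MeasurableSet {z : Fin t → X × I × ℝ | currentEpoch DX h π T Q z = k} := by
  have : Measurable fun z : Fin t → X × I × ℝ => currentEpoch DX h π T Q z := by
    refine measurable_findGreatest fun j _ => ?_
    have : {z : Fin t → X × I × ℝ | (epochState DX h π T Q z j).1 ≤ t} =
        ⋃ w : ℕ × Finset P, {z | epochState DX h π T Q z j = w} ∩ {_z | w.1 ≤ t} := by
      ext z; simp
    rw [this]
    exact MeasurableSet.iUnion fun w =>
      (measurableSet_epochState_eq hπ _ _ _).inter (MeasurableSet.const _)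
  exact this (measurableSet_singleton k)

lemma isRegularLearner_smoothPolicyElimination (hh : 0 < h) (hπ : ∀ p, Measurable (π p))
    [Nonempty P] (hQ : IsOptimizer DX h π Q) :
    IsRegularLearner (smoothPolicyElimination DX h π T Q) := by
  refine ⟨fun t => ?_, fun t z x => ?_⟩
  · simp only [smoothPolicyElimination_apply]
    refine measurable_of_countable_cases
      (c := fun y : (Fin t → X × I × ℝ) × X × I => currentEpoch DX h π T Q y.1)
      (F := fun k y => mixDensity h (exploreProb k) π (Q k (epochState DX h π T Q y.1 k).2)
        y.2.1 y.2.2) (fun k => measurable_fst (measurableSet_currentEpoch_eq hπ t k)) fun k => ?_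
    refine measurable_of_countable_cases
      (c := fun y : (Fin t → X × I × ℝ) × X × I => epochState DX h π T Q y.1 k)
      (F := fun w y => mixDensity h (exploreProb k) π (Q k w.2) y.2.1 y.2.2)
      (fun w => measurable_fst (measurableSet_epochState_eq hπ t k w)) fun w => ?_
    exact (measurable_mixDensity hπ _).comp measurable_snd
  · simp only [smoothPolicyElimination_apply]
    exact lintegral_mixDensity hh (exploreProb_pos _).le
      ((exploreProb_le_half _).trans (by norm_num)) π
      (hQ _ _ (epochState_nonempty z _)).1.1 x

end Epochs

/-! ### Concentration within an epoch -/

section RoundLaw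

variable [Fintype P] [MeasurableSpace X] [MeasurableSpace E]

/-- The law of a context, a loss function and an action drawn from the mixture density. -/
def roundLaw (D : Measure (X × E)) (h μ : ℝ) (π : P → X → I) (Q : P → ℝ) :
    Measure ((X × E) × I) :=
  (D.prod (volume : Measure I)).withDensity fun y =>
    ENNReal.ofReal (mixDensity h μ π Q y.1.1 y.2)

/-- The importance weighted loss of the policy `p`. -/
def weightedLoss (ℓ : E → I → ℝ) (h μ : ℝ) (π : P → X → I) (Q : P → ℝ) (p : P)
    (y : (X × E) × I) : ℝ :=
  smoothDensity h (π p y.1.1) y.2 * ℓ y.1.2 y.2 / mixDensity h μ π Q y.1.1 y.2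

variable {D : Measure (X × E)} {h μ : ℝ} {π : P → X → I} {Q : P → ℝ} {ℓ : E → I → ℝ}

lemma measurable_mixDensity_round (hπ : ∀ p, Measurable (π p)) :
    Measurable fun y : (X × E) × I => mixDensity h μ π Q y.1.1 y.2 := by
  have h0 : Measurable fun y : (X × E) × I => (y.1.1, y.2) := by fun_prop
  simpa only [Function.comp_def] using (measurable_mixDensity (h := h) (μ := μ) hπ Q).comp h0

lemma measurable_smoothDensity_round (hπ : ∀ p, Measurable (π p)) (p : P) :
    Measurable fun y : (X × E) × I => smoothDensity h (π p y.1.1) y.2 := by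
  have h0 : Measurable fun y : (X × E) × I => (y.1.1, y.2) := by fun_prop
  simpa only [Function.comp_def] using (measurable_smoothDensity_comp (h := h) (hπ p)).comp h0

lemma measurable_loss_round (hℓ : Measurable (Function.uncurry ℓ)) :
    Measurable fun y : (X × E) × I => ℓ y.1.2 y.2 := by
  have h0 : Measurable fun y : (X × E) × I => (y.1.2, y.2) := by fun_prop
  simpa only [Function.comp_def, Function.uncurry] using hℓ.comp h0

lemma measurable_weightedLoss (hℓ : Measurable (Function.uncurry ℓ))
    (hπ : ∀ p, Measurable (π p)) (p : P) :
    Measurable fun y : (X × E) × I => weightedLoss ℓ h μ π Q p y :=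
  ((measurable_smoothDensity_round hπ p).mul (measurable_loss_round hℓ)).div
    (measurable_mixDensity_round hπ)

lemma isProbabilityMeasure_roundLaw [IsProbabilityMeasure D] (hh : 0 < h) (hμ0 : 0 ≤ μ)
    (hμ : μ ≤ 1) (hπ : ∀ p, Measurable (π p)) (hQ : Q ∈ stdSimplex ℝ P) :
    IsProbabilityMeasure (roundLaw D h μ π Q) := by
  refine ⟨?_⟩
  rw [roundLaw, withDensity_apply _ MeasurableSet.univ, Measure.restrict_univ,
    lintegral_prod _ (measurable_mixDensity_round hπ).ennreal_ofReal.aemeasurable]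
  simp [lintegral_mixDensity hh hμ0 hμ π hQ]

lemma integral_roundLaw [IsProbabilityMeasure D] (hμ0 : 0 ≤ μ) (hμ : μ ≤ 1)
    (hπ : ∀ p, Measurable (π p)) (hQ : Q ∈ stdSimplex ℝ P) (f : (X × E) × I → ℝ) :
    ∫ y, f y ∂(roundLaw D h μ π Q) =
      ∫ y, mixDensity h μ π Q y.1.1 y.2 * f y ∂(D.prod (volume : Measure I)) := by
  rw [roundLaw, integral_withDensity_eq_integral_toReal_smul
    (measurable_mixDensity_round hπ).ennreal_ofReal
    (Filter.Eventually.of_forall fun y => ENNReal.ofReal_lt_top)]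
  refine integral_congr_ae (Filter.Eventually.of_forall fun y => ?_)
  simp only [smul_eq_mul]
  rw [ENNReal.toReal_ofReal (hμ0.trans (le_mixDensity hμ hQ.1 _ _))]

lemma integrable_of_mem_Icc {Ω : Type*} [MeasurableSpace Ω] {m : Measure Ω} [IsFiniteMeasure m]
    {f : Ω → ℝ} (hf : Measurable f) {C : ℝ} (h0 : ∀ y, 0 ≤ f y) (hC : ∀ y, f y ≤ C) :
    Integrable f m :=
  Integrable.of_bound hf.aestronglyMeasurable C (Filter.Eventually.of_forall fun y => by
    rw [Real.norm_of_nonneg (h0 y)]; exact hC y)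

lemma smoothedLoss_eq [IsProbabilityMeasure D] (hh : 0 < h) (hℓ : Measurable (Function.uncurry ℓ))
    (hℓ1 : ∀ e a, ℓ e a ∈ Set.Icc (0 : ℝ) 1) (hπ : ∀ p, Measurable (π p)) (p : P) :
    smoothedLoss D ℓ h (π p) =
      ∫ y, smoothDensity h (π p y.1.1) y.2 * ℓ y.1.2 y.2 ∂(D.prod (volume : Measure I)) := by
  rw [integral_prod]
  · simp only [smoothedLoss, integral_smooth]
  · refine integrable_of_mem_Icc
      ((measurable_smoothDensity_round hπ p).mul (measurable_loss_round hℓ))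
      (C := (min h 1)⁻¹ * 1)
      (fun y => mul_nonneg (smoothDensity_nonneg _ _ _) (hℓ1 _ _).1) fun y => ?_
    exact mul_le_mul (smoothDensity_le hh _ _) (hℓ1 _ _).2 (hℓ1 _ _).1
      (inv_nonneg.2 (lt_min hh one_pos).le)

lemma smoothedLoss_mem_Icc [IsProbabilityMeasure D] (hh : 0 < h)
    (hℓ : Measurable (Function.uncurry ℓ)) (hℓ1 : ∀ e a, ℓ e a ∈ Set.Icc (0 : ℝ) 1)
    (hπ : ∀ p, Measurable (π p)) (p : P) : smoothedLoss D ℓ h (π p) ∈ Set.Icc (0 : ℝ) 1 := by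
  have h1 : ∫ y : (X × E) × I, smoothDensity h (π p y.1.1) y.2 ∂(D.prod (volume : Measure I)) =
      1 := by
    rw [integral_prod]
    · simp [integral_smoothDensity hh]
    · exact integrable_of_mem_Icc (measurable_smoothDensity_round hπ p)
        (fun y => smoothDensity_nonneg _ _ _) fun y => smoothDensity_le hh _ _
  rw [smoothedLoss_eq hh hℓ hℓ1 hπ]
  refine ⟨integral_nonneg fun y => mul_nonneg (smoothDensity_nonneg _ _ _) (hℓ1 _ _).1, ?_⟩
  rw [← h1]
  refine integral_mono_of_nonneg
    (Filter.Eventually.of_forall fun y => mul_nonneg (smoothDensity_nonneg _ _ _) (hℓ1 _ _).1)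
    (integrable_of_mem_Icc (measurable_smoothDensity_round hπ p)
        (fun y => smoothDensity_nonneg _ _ _) fun y => smoothDensity_le hh _ _)
    (Filter.Eventually.of_forall fun y => ?_)
  exact mul_le_of_le_one_right (smoothDensity_nonneg _ _ _) (hℓ1 _ _).2

lemma weightedLoss_nonneg (hμ0 : 0 < μ) (hμ : μ ≤ 1) (hQ : Q ∈ stdSimplex ℝ P)
    (hℓ1 : ∀ e a, ℓ e a ∈ Set.Icc (0 : ℝ) 1) (p : P) (y : (X × E) × I) :
    0 ≤ weightedLoss ℓ h μ π Q p y :=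
  div_nonneg (mul_nonneg (smoothDensity_nonneg _ _ _) (hℓ1 _ _).1)
    (hμ0.le.trans (le_mixDensity hμ hQ.1 _ _))

lemma weightedLoss_le (hh : 0 < h) (hμ0 : 0 < μ) (hμ : μ ≤ 1) (hQ : Q ∈ stdSimplex ℝ P)
    (hℓ1 : ∀ e a, ℓ e a ∈ Set.Icc (0 : ℝ) 1) (p : P) (y : (X × E) × I) :
    weightedLoss ℓ h μ π Q p y ≤ (min h 1)⁻¹ * 1 / μ :=
  div_le_div₀ (mul_nonneg (inv_nonneg.2 (lt_min hh one_pos).le) zero_le_one)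
    (mul_le_mul (smoothDensity_le hh _ _) (hℓ1 _ _).2 (hℓ1 _ _).1
      (inv_nonneg.2 (lt_min hh one_pos).le)) hμ0 (le_mixDensity hμ hQ.1 _ _)

/-- Unbiasedness: the sampling density cancels the denominator, which is at least `μ > 0`. -/
lemma integral_weightedLoss [IsProbabilityMeasure D] (hh : 0 < h) (hμ0 : 0 < μ) (hμ : μ ≤ 1)
    (hπ : ∀ p, Measurable (π p)) (hQ : Q ∈ stdSimplex ℝ P)
    (hℓ : Measurable (Function.uncurry ℓ)) (hℓ1 : ∀ e a, ℓ e a ∈ Set.Icc (0 : ℝ) 1) (p : P) :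
    ∫ y, weightedLoss ℓ h μ π Q p y ∂(roundLaw D h μ π Q) = smoothedLoss D ℓ h (π p) := by
  rw [integral_roundLaw hμ0.le hμ hπ hQ, smoothedLoss_eq hh hℓ hℓ1 hπ]
  refine integral_congr_ae (Filter.Eventually.of_forall fun y => ?_)
  exact mul_div_cancel₀ _ (hμ0.trans_le (le_mixDensity hμ hQ.1 _ _)).ne'

/-- One factor `q` cancels. Of the two smoothed densities in the square, one is bounded by its
supremum and the other stays; the loss is at most one, so only the context marginal matters. -/
lemma integral_weightedLoss_sq_le [IsProbabilityMeasure D] (hh : 0 < h) (hμ0 : 0 < μ)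
    (hμ : μ ≤ 1) (hπ : ∀ p, Measurable (π p)) (hQ : Q ∈ stdSimplex ℝ P)
    (hℓ1 : ∀ e a, ℓ e a ∈ Set.Icc (0 : ℝ) 1) (p : P) :
    ∫ y, weightedLoss ℓ h μ π Q p y ^ 2 ∂(roundLaw D h μ π Q) ≤
      (min h 1)⁻¹ * ∫ y, smoothDensity h (π p y.1) y.2 * (mixDensity h μ π Q y.1 y.2)⁻¹
        ∂(D.fst.prod (volume : Measure I)) := by
  have hm : Measurable fun y : X × I =>
      smoothDensity h (π p y.1) y.2 * (mixDensity h μ π Q y.1 y.2)⁻¹ :=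
    (measurable_smoothDensity_comp (hπ p)).mul (measurable_mixDensity hπ Q).inv
  have hmp : MeasurePreserving (Prod.map Prod.fst id : (X × E) × I → X × I)
      (D.prod (volume : Measure I)) (D.fst.prod (volume : Measure I)) :=
    MeasurePreserving.prod ⟨measurable_fst, rfl⟩ (MeasurePreserving.id _)
  have hb : ∀ x a, |smoothDensity h (π p x) a| ≤ (min h 1)⁻¹ := fun x a => by
    rw [abs_of_nonneg (smoothDensity_nonneg _ _ _)]; exact smoothDensity_le hh _ _
  have hint := integrable_div_mixDensity (h := h) D.fst hμ0 hμ hπ hQ.1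
    (measurable_smoothDensity_comp (hπ p)) (fun y => hb y.1 y.2)
  have hint2 : Integrable (fun y : (X × E) × I => smoothDensity h (π p y.1.1) y.2 *
      (mixDensity h μ π Q y.1.1 y.2)⁻¹) (D.prod (volume : Measure I)) :=
    hmp.integrable_comp_of_integrable hint
  rw [integral_roundLaw hμ0.le hμ hπ hQ, ← hmp.map_eq,
    integral_map hmp.measurable.aemeasurable hm.aestronglyMeasurable, ← integral_const_mul]
  refine integral_mono_of_nonneg (Filter.Eventually.of_forall fun y =>
    mul_nonneg (hμ0.le.trans (le_mixDensity hμ hQ.1 _ _)) (sq_nonneg _))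
    (hint2.const_mul _) (Filter.Eventually.of_forall fun y => ?_)
  have hq := hμ0.trans_le (le_mixDensity (h := h) (π := π) hμ hQ.1 y.1.1 y.2)
  have hs0 := smoothDensity_nonneg h (π p y.1.1) y.2
  have hs1 := smoothDensity_le hh (π p y.1.1) y.2
  obtain ⟨hl0, hl1⟩ := hℓ1 y.1.2 y.2
  simp only [weightedLoss, Prod.map_fst, Prod.map_snd, id]
  have hl2 : ℓ y.1.2 y.2 ^ 2 ≤ 1 := pow_le_one₀ hl0 hl1
  calc mixDensity h μ π Q y.1.1 y.2 * (smoothDensity h (π p y.1.1) y.2 * ℓ y.1.2 y.2 /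
        mixDensity h μ π Q y.1.1 y.2) ^ 2
      = (smoothDensity h (π p y.1.1) y.2 * ℓ y.1.2 y.2 ^ 2) *
        (smoothDensity h (π p y.1.1) y.2 * (mixDensity h μ π Q y.1.1 y.2)⁻¹) := by
        field_simp
    _ ≤ (min h 1)⁻¹ * (smoothDensity h (π p y.1.1) y.2 * (mixDensity h μ π Q y.1.1 y.2)⁻¹) := by
        refine mul_le_mul_of_nonneg_right ?_ (mul_nonneg hs0 (inv_nonneg.2 hq.le))
        exact (mul_le_of_le_one_right hs0 hl2).trans hs1

/-- Chebyshev's inequality for the average of independent bounded random variables. -/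
lemma measure_pi_abs_average_sub_le {Ω : Type*} [MeasurableSpace Ω] (ν : Measure Ω)
    [IsProbabilityMeasure ν] {g : Ω → ℝ} (hg : MemLp g 2 ν) {n : ℕ} (hn : 0 < n) {r v : ℝ}
    (hr : 0 < r) (hv : ∫ y, g y ^ 2 ∂ν ≤ v) :
    (Measure.pi fun _ : Fin n => ν) {b | r < |(∑ j, g (b j)) / n - ∫ y, g y ∂ν|} ≤
      ENNReal.ofReal (v / (n * r ^ 2)) := by
  have hn' : (0 : ℝ) < n := Nat.cast_pos.2 hn
  set m := Measure.pi fun _ : Fin n => ν with hm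
  have hgj : ∀ j : Fin n, MemLp (fun b : Fin n → Ω => g (b j)) 2 m := fun j =>
    hg.comp_measurePreserving (measurePreserving_eval (fun _ : Fin n => ν) j)
  have hsum : MemLp (fun b : Fin n → Ω => (n : ℝ)⁻¹ * ∑ j, g (b j)) 2 m :=
    (memLp_finsetSum _ fun j _ => hgj j).const_mul _
  have hmean : ∫ b, (n : ℝ)⁻¹ * ∑ j, g (b j) ∂m = ∫ y, g y ∂ν := by
    rw [integral_const_mul, integral_finsetSum _ fun j _ => (hgj j).integrable (by norm_num)]
    have : ∀ j : Fin n, ∫ b, g (b j) ∂m = ∫ y, g y ∂ν := fun j => by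
      have h1 := measurePreserving_eval (fun _ : Fin n => ν) j
      conv_rhs => rw [← h1.map_eq]
      rw [integral_map h1.measurable.aemeasurable]
      rw [h1.map_eq]
      exact hg.aestronglyMeasurable
    simp only [this, Finset.sum_const, Finset.card_univ, Fintype.card_fin, nsmul_eq_mul]
    field_simp
  have hvar : Var[fun b : Fin n → Ω => (n : ℝ)⁻¹ * ∑ j, g (b j); m] ≤ v / n := by
    have h1 := variance_sum_pi (μ := fun _ : Fin n => ν) (X := fun _ => g) fun _ => hg
    have h2 : (∑ j : Fin n, fun b : Fin n → Ω => g (b j)) = fun b => ∑ j, g (b j) := by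
      funext b; simp
    rw [h2] at h1
    rw [variance_const_mul, h1]
    simp only [Finset.sum_const, Finset.card_univ, Fintype.card_fin, nsmul_eq_mul]
    have h3 : Var[g; ν] ≤ v := (variance_le_expectation_sq hg.aestronglyMeasurable).trans hv
    calc ((n : ℝ)⁻¹) ^ 2 * (n * Var[g; ν]) = Var[g; ν] / n := by field_simp
      _ ≤ v / n := by gcongr
  have hcheb := meas_ge_le_variance_div_sq hsum hr
  rw [hmean] at hcheb
  refine (measure_mono fun b hb => ?_).trans (hcheb.trans (ENNReal.ofReal_le_ofReal ?_))
  · have hb' : r < |(∑ j, g (b j)) / n - ∫ y, g y ∂ν| := hb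
    rw [div_eq_inv_mul] at hb'
    exact hb'.le
  · rw [← div_div]
    gcongr

end RoundLaw

/-! ### The probability that an estimate is off -/

section Failure

variable [Fintype P] [MeasurableSpace X] [MeasurableSpace E]
  {D : Measure (X × E)} {h μ : ℝ} {π : P → X → I} {ℓ : E → I → ℝ} {T : ℕ}
  {Q : ℕ → Finset P → P → ℝ}

lemma history_takeRounds {t T : ℕ} (htT : t ≤ T) (ω : Fin T → (X × E) × I) :
    history ℓ (takeRounds htT ω) = takeRounds htT (history ℓ ω) := rfl

lemma past_eq_takeRounds {T : ℕ} (ω : Fin T → (X × E) × I) (t : Fin T) :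
    past ℓ ω t = takeRounds t.isLt.le (history ℓ ω) := rfl

lemma measurable_takeRounds {α : Type*} [MeasurableSpace α] {t T : ℕ} (htT : t ≤ T) :
    Measurable fun ω : Fin T → α => takeRounds htT ω :=
  measurable_pi_lambda _ fun _ => measurable_pi_apply _

lemma map_takeRounds_interactionLaw [IsProbabilityMeasure D] {A : Learner X}
    (hℓ : Measurable (Function.uncurry ℓ))
    (hA : IsRegularLearner A) {t T : ℕ} (htT : t ≤ T) :
    (interactionLaw D ℓ A T).map (takeRounds htT) = interactionLaw D ℓ A t :=
  map_castLE_interactionLaw D hℓ hA htT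

lemma batchEstimate_history_add {Q : P → ℝ} {s n i u : ℕ} (hu : s + i * n = u)
    (ω : Fin (u + n) → (X × E) × I) (p : P) :
    batchEstimate h μ π Q s n (history ℓ ω) i p =
      (∑ j : Fin n, weightedLoss ℓ h μ π Q p (ω (Fin.natAdd u j))) / n := by
  have hu' : s + (i + 1) * n = u + n := by rw [add_mul, one_mul, ← hu, add_assoc]
  unfold batchEstimate
  rw [Finset.sum_filter, Fin.sum_univ_add, hu, hu']
  congr 1
  have h1 : ∀ j : Fin u, ¬ (u ≤ ((Fin.castAdd n j : Fin (u + n)) : ℕ) ∧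
      ((Fin.castAdd n j : Fin (u + n)) : ℕ) < u + n) := fun j hj => by
    have := j.2
    simp only [Fin.val_castAdd] at hj
    omega
  have h2 : ∀ j : Fin n, (u ≤ ((Fin.natAdd u j : Fin (u + n)) : ℕ) ∧
      ((Fin.natAdd u j : Fin (u + n)) : ℕ) < u + n) := fun j => by
    have := j.2
    simp only [Fin.val_natAdd]
    omega
  rw [Finset.sum_eq_zero fun j _ => if_neg (h1 j), zero_add]
  exact Finset.sum_congr rfl fun j _ => if_pos (h2 j)

/-- On the event that epoch `k` begins in round `w.1` with the version space `w.2`, the density of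
its actions is the one computed from `w`. -/
lemma stepDensity_eq_of_epochState [IsProbabilityMeasure D] (hh : 0 < h)
    (hπ : ∀ p, Measurable (π p)) (hT : 2 ≤ T) (hP : 2 ≤ Fintype.card P) {u n k : ℕ}
    {w : ℕ × Finset P} (ω : Fin (u + n) → (X × E) × I)
    (hω : epochState D.fst h π T Q (history ℓ (takeRounds (Nat.le_add_right u n) ω)) k = w)
    (hw : w.1 ≤ u) (hun : u + n ≤ w.1 + epochLength D.fst h π T k w.2) (j : Fin n) :
    stepDensity ℓ (smoothPolicyElimination D.fst h π T Q) ω (Fin.natAdd u j) =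
      ENNReal.ofReal (mixDensity h (exploreProb k) π (Q k w.2) (ω (Fin.natAdd u j)).1.1
        (ω (Fin.natAdd u j)).2) := by
  have hle : u ≤ ((Fin.natAdd u j : Fin (u + n)) : ℕ) := by simp
  have h1 : epochState D.fst h π T Q (past ℓ ω (Fin.natAdd u j)) k = w := by
    rw [past_eq_takeRounds]
    exact (epochState_takeRounds_eq_iff hle
      (takeRounds (Fin.natAdd u j).isLt.le (history ℓ ω)) k hw).1 hω
  have h2 : currentEpoch D.fst h π T Q (past ℓ ω (Fin.natAdd u j)) = k := by
    refine currentEpoch_eq hh hπ hT hP ?_ ?_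
    · rw [h1]; exact hw.trans hle
    · rw [epochState_succ_fst, h1]
      exact lt_of_lt_of_le (Fin.natAdd u j).isLt hun
  unfold stepDensity
  rw [smoothPolicyElimination_apply, h2, h1]

/-- The weight that a batch gets in the exponential moment of the number of bad batches. -/
def batchWeight (r c x : ℝ) : ENNReal := if r < |x - c| then 160 else 1

lemma measurable_batchWeight (r c : ℝ) : Measurable (batchWeight r c) := by
  unfold batchWeight
  refine Measurable.ite ?_ measurable_const measurable_const
  exact measurableSet_lt measurable_const ((measurable_id.sub_const c).abs)

lemma le_prod_batchWeight {d : ℕ} {f : ℕ → ℝ} {r c : ℝ}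
    (hf : r < |median (fun i : Fin d => f i) - c|) :
    (12 : ENNReal) ^ d ≤ ∏ i ∈ Finset.range d, batchWeight r c (f i) := by
  have h1 := le_two_mul_card_of_lt_abs_median_sub hf
  rw [Finset.prod_range]
  unfold batchWeight
  rw [Finset.prod_ite, Finset.prod_const, Finset.prod_const_one, mul_one]
  -- At least half of the batches are bad, and `12² = 144 ≤ 160`.
  calc (12 : ENNReal) ^ d
      ≤ 12 ^ (2 * (Finset.univ.filter fun j : Fin d => r < |f j - c|).card) :=
        pow_le_pow_right₀ (by norm_num) h1
    _ ≤ 160 ^ (Finset.univ.filter fun j : Fin d => r < |f j - c|).card := by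
        rw [pow_mul]
        gcongr
        norm_num

variable [IsProbabilityMeasure D]

/-- The mean weight is at most `1 + 160 · P(bad)`, and Chebyshev bounds the probability by `1/160`.
-/
lemma lintegral_batchWeight_le (hh : 0 < h) (hh1 : h ≤ 1) (hπ : ∀ p, Measurable (π p))
    (hℓ : Measurable (Function.uncurry ℓ)) (hℓ1 : ∀ e a, ℓ e a ∈ Set.Icc (0 : ℝ) 1)
    (hQ : IsOptimizer D.fst h π Q) (k : ℕ) {S : Finset P} {p : P} (hp : p ∈ S) :
    ∫⁻ b, batchWeight (radius k) (smoothedLoss D ℓ h (π p))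
        ((∑ j, weightedLoss ℓ h (exploreProb k) π (Q k S) p (b j)) / batchSize D.fst h π k S)
      ∂(Measure.pi fun _ : Fin (batchSize D.fst h π k S) =>
        roundLaw D h (exploreProb k) π (Q k S)) ≤ 2 := by
  have hS : S.Nonempty := ⟨p, hp⟩
  have hμ0 := exploreProb_pos k
  have hμ1 : exploreProb k ≤ 1 := (exploreProb_le_half k).trans (by norm_num)
  have hQS := (hQ k S hS).1.1
  have hprob := isProbabilityMeasure_roundLaw (D := D) hh hμ0.le hμ1 hπ hQS
  have hr := radius_pos k
  set ν := roundLaw D h (exploreProb k) π (Q k S)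
  set n := batchSize D.fst h π k S with hn
  set g := weightedLoss ℓ h (exploreProb k) π (Q k S) p
  have hn0 : 0 < n := batchSize_pos hh hπ k hS
  have hgm : Measurable g := measurable_weightedLoss hℓ hπ p
  have hg : MemLp g 2 ν := by
    refine MemLp.of_bound hgm.aestronglyMeasurable ((min h 1)⁻¹ * 1 / exploreProb k)
      (Filter.Eventually.of_forall fun y => ?_)
    rw [Real.norm_of_nonneg (weightedLoss_nonneg hμ0 hμ1 hQS hℓ1 p y)]
    exact weightedLoss_le hh hμ0 hμ1 hQS hℓ1 p y
  have hV0 : 0 < charVolume D.fst h π S :=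
    (lt_min hh one_pos).trans_le (min_le_charVolume D.fst hh hπ hS)
  have hsq : ∫ y, g y ^ 2 ∂ν ≤ h⁻¹ * (2 * charVolume D.fst h π S) := by
    refine (integral_weightedLoss_sq_le hh hμ0 hμ1 hπ hQS hℓ1 p).trans ?_
    rw [min_eq_left hh1]
    exact mul_le_mul_of_nonneg_left (hQ.integral_div_mixDensity_le hh hπ k hp)
      (inv_nonneg.2 hh.le)
  have hcheb := measure_pi_abs_average_sub_le ν hg hn0 hr hsq
  rw [integral_weightedLoss hh hμ0 hμ1 hπ hQS hℓ hℓ1] at hcheb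
  -- The constant 320 in the batch size is `2 · 160`, the 2 coming from the variance constraint.
  have hbound : h⁻¹ * (2 * charVolume D.fst h π S) / (n * radius k ^ 2) ≤ 1 / 160 := by
    have h1 := le_batchSize D.fst h π k S
    rw [← hn, div_le_iff₀ (by positivity)] at h1
    rw [div_le_div_iff₀ (by positivity) (by norm_num)]
    have h2 : h⁻¹ * (2 * charVolume D.fst h π S) * 160 =
      h⁻¹ * (320 * charVolume D.fst h π S) := by ring
    rw [h2, inv_mul_le_iff₀ hh]
    linarith
  have hset : MeasurableSet {b : Fin n → (X × E) × I |
      radius k < |(∑ j, g (b j)) / n - smoothedLoss D ℓ h (π p)|} := by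
    refine measurableSet_lt measurable_const (Measurable.abs (Measurable.sub_const
      (Measurable.div_const (Finset.measurable_fun_sum _ fun j _ => ?_) _) _))
    exact hgm.comp (measurable_pi_apply j)
  calc ∫⁻ b, batchWeight (radius k) (smoothedLoss D ℓ h (π p)) ((∑ j, g (b j)) / n)
        ∂(Measure.pi fun _ : Fin n => ν)
      ≤ ∫⁻ b, (1 + {b : Fin n → (X × E) × I |
          radius k < |(∑ j, g (b j)) / n - smoothedLoss D ℓ h (π p)|}.indicator
            (fun _ => (160 : ENNReal)) b) ∂(Measure.pi fun _ : Fin n => ν) := by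
        refine lintegral_mono fun b => ?_
        by_cases hb : radius k < |(∑ j, g (b j)) / n - smoothedLoss D ℓ h (π p)|
        · simp [batchWeight, hb]
        · simp [batchWeight, hb]
    _ ≤ 1 + 160 * ENNReal.ofReal (1 / 160) := by
        rw [lintegral_add_left measurable_const, lintegral_indicator_const hset, lintegral_one,
          measure_univ]
        gcongr
        exact hcheb.trans (ENNReal.ofReal_le_ofReal hbound)
    _ = 2 := by
        rw [show (160 : ENNReal) = ENNReal.ofReal 160 by simp,
          ← ENNReal.ofReal_mul (by norm_num)]
        norm_num

-- Induction on the batches of the epoch. Given that the epoch starts in state `w`, the next batch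
-- is independent of the previous ones, so it multiplies the bound by at most 2.
open Classical in
lemma lintegral_prod_batchWeight_le (hh : 0 < h) (hh1 : h ≤ 1) (hπ : ∀ p, Measurable (π p))
    (hℓ : Measurable (Function.uncurry ℓ)) (hℓ1 : ∀ e a, ℓ e a ∈ Set.Icc (0 : ℝ) 1)
    (hT : 2 ≤ T) (hP : 2 ≤ Fintype.card P)
    (hQ : IsOptimizer D.fst h π Q) (k : ℕ) {w : ℕ × Finset P} {p : P} (hp : p ∈ w.2) (i : ℕ)
    (hi : i ≤ numBatches T (Fintype.card P)) (u : ℕ)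
    (hu : w.1 + i * batchSize D.fst h π k w.2 = u) :
    ∫⁻ ω, (if epochState D.fst h π T Q (history ℓ ω) k = w then 1 else 0) *
        ∏ j ∈ Finset.range i, batchWeight (radius k) (smoothedLoss D ℓ h (π p))
          (batchEstimate h (exploreProb k) π (Q k w.2) w.1 (batchSize D.fst h π k w.2)
            (history ℓ ω) j p)
        ∂(interactionLaw D ℓ (smoothPolicyElimination D.fst h π T Q) u) ≤
      interactionLaw D ℓ (smoothPolicyElimination D.fst h π T Q) w.1
        {ω | epochState D.fst h π T Q (history ℓ ω) k = w} * 2 ^ i := by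
  have hne : Nonempty P := ⟨p⟩
  have hA := isRegularLearner_smoothPolicyElimination (T := T) hh hπ hQ
  have hset : ∀ t, MeasurableSet
      {ω : Fin t → (X × E) × I | epochState D.fst h π T Q (history ℓ ω) k = w} := fun t =>
    measurable_history hℓ t (measurableSet_epochState_eq hπ t k w)
  set n := batchSize D.fst h π k w.2 with hn
  set W : (t : ℕ) → (Fin t → (X × E) × I) → ℕ → ENNReal := fun t ω j =>
    batchWeight (radius k) (smoothedLoss D ℓ h (π p))
      (batchEstimate h (exploreProb k) π (Q k w.2) w.1 n (history ℓ ω) j p) with hW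
  set A := smoothPolicyElimination D.fst h π T Q
  induction i generalizing u with
  | zero =>
    have hu' : u = w.1 := by omega
    subst hu'
    simp only [Finset.range_zero, Finset.prod_empty, mul_one, pow_zero]
    have h1 : ∀ ω : Fin w.1 → (X × E) × I,
        (if epochState D.fst h π T Q (history ℓ ω) k = w then (1 : ENNReal) else 0) =
          {ω | epochState D.fst h π T Q (history ℓ ω) k = w}.indicator 1 ω := fun ω => by
      by_cases h2 : epochState D.fst h π T Q (history ℓ ω) k = w <;> simp [h2]
    simp_rw [h1]
    rw [lintegral_indicator_one (hset _)]
  | succ i ih =>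
    have hid : i ≤ numBatches T (Fintype.card P) := by omega
    obtain ⟨v, hv⟩ : ∃ v, w.1 + i * n = v := ⟨_, rfl⟩
    have huv : u = v + n := by rw [← hu, ← hv, add_mul, one_mul, add_assoc]
    subst huv
    have hμ1 : exploreProb k ≤ 1 := (exploreProb_le_half k).trans (by norm_num)
    have hprob : IsProbabilityMeasure ((D.prod (volume : Measure I)).withDensity
        fun y => ENNReal.ofReal (mixDensity h (exploreProb k) π (Q k w.2) y.1.1 y.2)) :=
      isProbabilityMeasure_roundLaw hh (exploreProb_pos k).le hμ1 hπ (hQ k w.2 ⟨p, hp⟩).1.1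
    have hwv : w.1 ≤ v := by omega
    have hWm : ∀ t j, Measurable fun ω => W t ω j := fun t j =>
      (measurable_batchWeight _ _).comp
        ((measurable_batchEstimate hπ _ _ _ _ _).comp (measurable_history hℓ t))
    set f : (Fin v → (X × E) × I) → ENNReal := fun a =>
      (if epochState D.fst h π T Q (history ℓ a) k = w then 1 else 0) *
        ∏ j ∈ Finset.range i, W v a j with hf
    set H : (Fin n → (X × E) × I) → ENNReal := fun b =>
      batchWeight (radius k) (smoothedLoss D ℓ h (π p))
        ((∑ j, weightedLoss ℓ h (exploreProb k) π (Q k w.2) p (b j)) / n) with hH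
    have hfm : Measurable f :=
      (Measurable.ite (hset v) measurable_const measurable_const).mul
        (Finset.measurable_fun_prod _ fun j _ => hWm v j)
    have hHm : Measurable H := by
      refine (measurable_batchWeight _ _).comp (Measurable.div_const
        (Finset.measurable_fun_sum _ fun j _ => ?_) _)
      exact (measurable_weightedLoss hℓ hπ p).comp (measurable_pi_apply j)
    -- The event and the first `i` weights depend on the first `v` rounds only, the new weight on
    -- the last `n` rounds only.
    have hsplit : ∀ ω : Fin (v + n) → (X × E) × I,
        (if epochState D.fst h π T Q (history ℓ ω) k = w then (1 : ENNReal) else 0) *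
          ∏ j ∈ Finset.range (i + 1), W (v + n) ω j =
        f (fun s => ω (Fin.castAdd n s)) * H (fun j => ω (Fin.natAdd v j)) := by
      intro ω
      have h1 := epochState_takeRounds_eq_iff (DX := D.fst) (h := h) (π := π) (T := T) (Q := Q)
        (Nat.le_add_right v n) (history ℓ ω) k hwv
      have h2 : ∀ j ∈ Finset.range i,
          W (v + n) ω j = W v (takeRounds (Nat.le_add_right v n) ω) j := by
        intro j hj
        have hj' : w.1 + (j + 1) * n ≤ v := by
          rw [← hv]
          have := Nat.mul_le_mul_right n (Nat.succ_le_of_lt (Finset.mem_range.1 hj))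
          simpa using this
        simp only [hW]
        rw [history_takeRounds, batchEstimate_takeRounds (Nat.le_add_right v n) _ j p hj']
      have h3 : W (v + n) ω i = H (fun j => ω (Fin.natAdd v j)) := by
        simp only [hW, hH]
        rw [batchEstimate_history_add hv]
      rw [Finset.prod_range_succ, Finset.prod_congr rfl h2, h3, ← mul_assoc]
      congr 2
      exact if_congr h1.symm rfl rfl
    -- The new batch still lies inside the epoch, so its action density is the one determined by
    -- `w`.
    have hun : v + n ≤ w.1 + epochLength D.fst h π T k w.2 := by
      have : (i + 1) * n ≤ n * numBatches T (Fintype.card P) := by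
        rw [mul_comm n]; exact Nat.mul_le_mul_right n hi
      rw [← hu]
      exact Nat.add_le_add_left this _
    calc ∫⁻ ω, (if epochState D.fst h π T Q (history ℓ ω) k = w then 1 else 0) *
          ∏ j ∈ Finset.range (i + 1), W (v + n) ω j ∂(interactionLaw D ℓ A (v + n))
        = ∫⁻ ω, f (fun s => ω (Fin.castAdd n s)) * H (fun j => ω (Fin.natAdd v j))
            ∂(interactionLaw D ℓ A (v + n)) := lintegral_congr hsplit
      _ = (∫⁻ a, f a ∂(interactionLaw D ℓ A v)) * ∫⁻ b, H b ∂(Measure.pi fun _ : Fin n =>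
            (D.prod (volume : Measure I)).withDensity
            fun y => ENNReal.ofReal (mixDensity h (exploreProb k) π (Q k w.2) y.1.1 y.2)) := by
          refine lintegral_interactionLaw_mul D hℓ hA v n
            (measurable_mixDensity_round hπ).ennreal_ofReal hfm hHm ?_
          intro a b ha j
          have ha' : epochState D.fst h π T Q (history ℓ a) k = w := by
            by_contra hcon
            exact ha (by simp [hf, hcon])
          have htake : takeRounds (Nat.le_add_right v n) (Fin.append a b) = a := by
            funext s; exact Fin.append_left a b s
          have := stepDensity_eq_of_epochState (D := D) (ℓ := ℓ) hh hπ hT hP (Fin.append a b)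
            (by rw [htake]; exact ha') hwv hun j
          rw [this, Fin.append_right]
      _ ≤ (interactionLaw D ℓ A w.1
            {ω | epochState D.fst h π T Q (history ℓ ω) k = w} * 2 ^ i) * 2 := by
          gcongr
          · exact ih hid v hv
          · exact lintegral_batchWeight_le hh hh1 hπ hℓ hℓ1 hQ k hp
      _ = _ := by rw [mul_assoc, ← pow_succ]

lemma measurableSet_abs_epochEstimate (hπ : ∀ p, Measurable (π p))
    (hℓ : Measurable (Function.uncurry ℓ)) (t k : ℕ) (w : ℕ × Finset P) (p : P) (r c : ℝ) :
    MeasurableSet {ω : Fin t → (X × E) × I | epochState D.fst h π T Q (history ℓ ω) k = w ∧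
      r < |epochEstimate D.fst h π T Q (history ℓ ω) k w p - c|} := by
  refine (measurable_history hℓ t (measurableSet_epochState_eq hπ t k w)).inter ?_
  exact measurableSet_lt measurable_const
    ((((measurable_epochEstimate hπ t k w p).comp (measurable_history hℓ t)).sub_const c).abs)

/-- Markov's inequality for the product of the batch weights: it is at least `12^d` where the median
is off, while its integral over the event is at most `2^d` times the probability of the event. -/
lemma pow_mul_measure_epochEstimate_le (hh : 0 < h) (hh1 : h ≤ 1) (hπ : ∀ p, Measurable (π p))
    (hℓ : Measurable (Function.uncurry ℓ)) (hℓ1 : ∀ e a, ℓ e a ∈ Set.Icc (0 : ℝ) 1)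
    (hT : 2 ≤ T) (hP : 2 ≤ Fintype.card P)
    (hQ : IsOptimizer D.fst h π Q) (k : ℕ) {w : ℕ × Finset P} {p : P} (hp : p ∈ w.2)
    (hw : w.1 + epochLength D.fst h π T k w.2 ≤ T) :
    6 ^ numBatches T (Fintype.card P) *
        interactionLaw D ℓ (smoothPolicyElimination D.fst h π T Q) T
          {ω | epochState D.fst h π T Q (history ℓ ω) k = w ∧ radius k <
            |epochEstimate D.fst h π T Q (history ℓ ω) k w p - smoothedLoss D ℓ h (π p)|} ≤
      interactionLaw D ℓ (smoothPolicyElimination D.fst h π T Q) T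
        {ω | epochState D.fst h π T Q (history ℓ ω) k = w} := by
  classical
  have hne : Nonempty P := ⟨p⟩
  have hA := isRegularLearner_smoothPolicyElimination (T := T) hh hπ hQ
  set A := smoothPolicyElimination D.fst h π T Q
  set d := numBatches T (Fintype.card P) with hd
  set c := smoothedLoss D ℓ h (π p)
  set u := w.1 + epochLength D.fst h π T k w.2 with hu
  have hwT : w.1 ≤ T := by omega
  have hwu : w.1 ≤ u := by omega
  have hset : ∀ t, MeasurableSet
      {ω : Fin t → (X × E) × I | epochState D.fst h π T Q (history ℓ ω) k = w} := fun t =>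
    measurable_history hℓ t (measurableSet_epochState_eq hπ t k w)
  -- The state is decided by round `w.1` and the estimate by round `u`, so both events may be
  -- measured at horizon `T`.
  have hB : interactionLaw D ℓ A w.1 {ω | epochState D.fst h π T Q (history ℓ ω) k = w} =
      interactionLaw D ℓ A T {ω | epochState D.fst h π T Q (history ℓ ω) k = w} := by
    rw [← map_takeRounds_interactionLaw hℓ hA hwT,
      Measure.map_apply (measurable_takeRounds hwT) (hset _)]
    congr 1
    ext ω
    exact epochState_takeRounds_eq_iff hwT (history ℓ ω) k le_rfl
  have hF : interactionLaw D ℓ A u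
        {ω | epochState D.fst h π T Q (history ℓ ω) k = w ∧ radius k <
          |epochEstimate D.fst h π T Q (history ℓ ω) k w p - c|} =
      interactionLaw D ℓ A T
        {ω | epochState D.fst h π T Q (history ℓ ω) k = w ∧ radius k <
          |epochEstimate D.fst h π T Q (history ℓ ω) k w p - c|} := by
    rw [← map_takeRounds_interactionLaw hℓ hA hw,
      Measure.map_apply (measurable_takeRounds hw)
        (measurableSet_abs_epochEstimate hπ hℓ _ _ _ _ _ _)]
    congr 1
    ext ω
    refine and_congr (epochState_takeRounds_eq_iff hw (history ℓ ω) k hwu) ?_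
    rw [history_takeRounds, epochEstimate_takeRounds hw _ _ _ _ le_rfl]
  have hmain := lintegral_prod_batchWeight_le hh hh1 hπ hℓ hℓ1 hT hP hQ k hp d le_rfl u
    (by rw [hu, epochLength, mul_comm])
  rw [← hB, ← hF]
  have h2 : (2 : ENNReal) ^ d ≠ 0 := by positivity
  have h2' : (2 : ENNReal) ^ d ≠ ⊤ := ENNReal.pow_ne_top (by norm_num)
  rw [← ENNReal.mul_le_mul_iff_right h2 h2', ← mul_assoc, ← mul_pow, mul_comm (2 ^ d)
    (interactionLaw D ℓ A w.1 _)]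
  refine le_trans ?_ hmain
  rw [← lintegral_indicator_const (measurableSet_abs_epochEstimate hπ hℓ _ _ _ _ _ _)]
  refine lintegral_mono fun ω => ?_
  beta_reduce
  rw [Set.indicator_apply]
  split_ifs with hω h3 h3
  rotate_left
  · exact absurd hω.1 h3
  · exact zero_le
  · exact zero_le
  obtain ⟨-, h4⟩ := hω
  rw [one_mul]
  refine le_trans ?_ (le_prod_batchWeight h4)
  norm_num

/-- The event that the estimate of `p` in the completed epoch `k` is off. -/
def failureSet (D : Measure (X × E)) (h : ℝ) (π : P → X → I) (ℓ : E → I → ℝ) (T : ℕ)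
    (Q : ℕ → Finset P → P → ℝ) (k : ℕ) (p : P) : Set (Fin T → (X × E) × I) :=
  {ω | (epochState D.fst h π T Q (history ℓ ω) (k + 1)).1 ≤ T ∧
    p ∈ (epochState D.fst h π T Q (history ℓ ω) k).2 ∧ radius k <
      |epochEstimate D.fst h π T Q (history ℓ ω) k (epochState D.fst h π T Q (history ℓ ω) k) p -
        smoothedLoss D ℓ h (π p)|}

/-- Split by the state in which epoch `k` begins. Each bound is relative to the probability of that
state, and these probabilities add up to at most one. -/
lemma pow_mul_measure_failureSet_le (hh : 0 < h) (hh1 : h ≤ 1) (hπ : ∀ p, Measurable (π p))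
    (hℓ : Measurable (Function.uncurry ℓ)) (hℓ1 : ∀ e a, ℓ e a ∈ Set.Icc (0 : ℝ) 1)
    (hT : 2 ≤ T) (hP : 2 ≤ Fintype.card P)
    (hQ : IsOptimizer D.fst h π Q) (k : ℕ) (p : P) :
    6 ^ numBatches T (Fintype.card P) *
        interactionLaw D ℓ (smoothPolicyElimination D.fst h π T Q) T
          (failureSet D h π ℓ T Q k p) ≤ 1 := by
  classical
  have hne : Nonempty P := ⟨p⟩
  have hA := isRegularLearner_smoothPolicyElimination (T := T) hh hπ hQ
  have hprob := isProbabilityMeasure_interactionLaw D hℓ hA T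
  set A := smoothPolicyElimination D.fst h π T Q
  set W : Finset (ℕ × Finset P) := (Finset.range (T + 1) ×ˢ Finset.univ).filter fun w =>
    p ∈ w.2 ∧ w.1 + epochLength D.fst h π T k w.2 ≤ T with hW
  have hsub : failureSet D h π ℓ T Q k p ⊆ ⋃ w ∈ W,
      {ω | epochState D.fst h π T Q (history ℓ ω) k = w ∧ radius k <
        |epochEstimate D.fst h π T Q (history ℓ ω) k w p - smoothedLoss D ℓ h (π p)|} := by
    rintro ω ⟨h1, h2, h3⟩
    rw [epochState_succ_fst] at h1
    refine Set.mem_biUnion (x := epochState D.fst h π T Q (history ℓ ω) k) ?_ ⟨rfl, h3⟩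
    simp only [hW, Finset.coe_filter, Finset.mem_product, Finset.mem_range, Finset.mem_univ,
      and_true]
    exact ⟨by omega, h2, h1⟩
  calc _ ≤ 6 ^ numBatches T (Fintype.card P) * ∑ w ∈ W, interactionLaw D ℓ A T
          {ω | epochState D.fst h π T Q (history ℓ ω) k = w ∧ radius k <
            |epochEstimate D.fst h π T Q (history ℓ ω) k w p - smoothedLoss D ℓ h (π p)|} := by
        gcongr
        exact (measure_mono hsub).trans (measure_biUnion_finset_le _ _)
    _ ≤ ∑ w ∈ W, interactionLaw D ℓ A T
          {ω | epochState D.fst h π T Q (history ℓ ω) k = w} := by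
        rw [Finset.mul_sum]
        refine Finset.sum_le_sum fun w hw => ?_
        obtain ⟨-, h1, h2⟩ := Finset.mem_filter.1 hw
        exact pow_mul_measure_epochEstimate_le hh hh1 hπ hℓ hℓ1 hT hP hQ k h1 h2
    _ = interactionLaw D ℓ A T
          (⋃ w ∈ W, {ω | epochState D.fst h π T Q (history ℓ ω) k = w}) := by
        rw [measure_biUnion_finset]
        · intro w _ w' _ hww'
          refine Set.disjoint_left.2 fun ω h1 h2 => hww' ?_
          have h1' : epochState D.fst h π T Q (history ℓ ω) k = w := h1
          have h2' : epochState D.fst h π T Q (history ℓ ω) k = w' := h2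
          rw [← h1', h2']
        · exact fun w _ => measurable_history hℓ T (measurableSet_epochState_eq hπ T k w)
    _ ≤ 1 := prob_le_one

/-- With probability at least `1 - 1 / T` all estimates of completed epochs are accurate. -/
lemma mul_measure_iUnion_failureSet_le (hh : 0 < h) (hh1 : h ≤ 1) (hπ : ∀ p, Measurable (π p))
    (hℓ : Measurable (Function.uncurry ℓ)) (hℓ1 : ∀ e a, ℓ e a ∈ Set.Icc (0 : ℝ) 1)
    (hT : 2 ≤ T) (hP : 2 ≤ Fintype.card P) (hQ : IsOptimizer D.fst h π Q) :
    T * interactionLaw D ℓ (smoothPolicyElimination D.fst h π T Q) T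
      (⋃ k ∈ Finset.range T, ⋃ p ∈ Finset.univ, failureSet D h π ℓ T Q k p) ≤ 1 := by
  set m := interactionLaw D ℓ (smoothPolicyElimination D.fst h π T Q) T
  set d := numBatches T (Fintype.card P) with hd
  set N := Fintype.card P
  have h6 : (6 : ENNReal) ^ d ≠ 0 := by positivity
  have h6' : (6 : ENNReal) ^ d ≠ ⊤ := ENNReal.pow_ne_top (by norm_num)
  -- Since `6 > e`, `6^d ≥ (TN)^5`. The product `T * N` pays for the union over epochs and policies,
  -- the extra `T` for the regret on failure.
  have hpow : T * (T * N) ≤ 6 ^ d := by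
    obtain ⟨h1, h2⟩ := four_le_mul_and_mul_le_mul_logb hT hP
    have h3 : Real.log (T * N) ≤ ⌈Real.log (T * N * Real.logb 2 T)⌉₊ :=
      (Real.log_le_log (by linarith) h2).trans (Nat.le_ceil _)
    have h4 : ((T : ℝ) * N) ≤ Real.exp 1 ^ ⌈Real.log (T * N * Real.logb 2 T)⌉₊ := by
      rw [← Real.exp_nat_mul, mul_one]
      calc ((T : ℝ) * N) = Real.exp (Real.log (T * N)) := (Real.exp_log (by linarith)).symm
        _ ≤ _ := Real.exp_le_exp.2 h3
    have h5 : ((T : ℝ) * N) ^ 5 ≤ 6 ^ d := by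
      rw [hd, numBatches, mul_comm 5, pow_mul]
      refine pow_le_pow_left₀ (by linarith) (h4.trans ?_) 5
      exact pow_le_pow_left₀ (Real.exp_pos 1).le (by linarith [Real.exp_one_lt_d9]) _
    have hN1 : (1 : ℝ) ≤ N := by exact_mod_cast (by omega : 1 ≤ N)
    have hT1 : (1 : ℝ) ≤ T := by exact_mod_cast (by omega : 1 ≤ T)
    have h7 : (T : ℝ) * (T * N) ≤ 6 ^ d := by
      calc (T : ℝ) * (T * N) ≤ (T * N) * (T * N) := by
            gcongr; exact le_mul_of_one_le_right (by linarith) hN1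
        _ = (T * N) ^ 2 := by ring
        _ ≤ (T * N) ^ 5 := pow_le_pow_right₀ (by linarith) (by norm_num)
        _ ≤ _ := h5
    exact_mod_cast h7
  have hunion : m (⋃ k ∈ Finset.range T, ⋃ p ∈ Finset.univ, failureSet D h π ℓ T Q k p) ≤
      ∑ k ∈ Finset.range T, ∑ p, m (failureSet D h π ℓ T Q k p) :=
    (measure_biUnion_finset_le _ _).trans
      (Finset.sum_le_sum fun k _ => measure_biUnion_finset_le _ _)
  rw [← ENNReal.mul_le_mul_iff_right h6 h6', mul_one]
  calc 6 ^ d * (T * m (⋃ k ∈ Finset.range T, ⋃ p ∈ Finset.univ, failureSet D h π ℓ T Q k p))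
      ≤ 6 ^ d * (T * ∑ k ∈ Finset.range T, ∑ p, m (failureSet D h π ℓ T Q k p)) := by gcongr
    _ = T * ∑ k ∈ Finset.range T, ∑ p, 6 ^ d * m (failureSet D h π ℓ T Q k p) := by
        simp only [← Finset.mul_sum]; ring
    _ ≤ T * ∑ k ∈ Finset.range T, ∑ p : P, 1 := by
        gcongr
        exact pow_mul_measure_failureSet_le hh hh1 hπ hℓ hℓ1 hT hP hQ _ _
    _ = ((T * (T * N) : ℕ) : ENNReal) := by simp [N]
    _ ≤ ((6 ^ d : ℕ) : ENNReal) := by exact_mod_cast hpow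
    _ = 6 ^ d := by norm_num

end Failure

/-! ### The regret -/

section Regret

variable [Fintype P] [MeasurableSpace X] [MeasurableSpace E]
  {D : Measure (X × E)} {h μ : ℝ} {π : P → X → I} {ℓ : E → I → ℝ} {T : ℕ}
  {Q : ℕ → Finset P → P → ℝ}

/-- The expected loss of a round, given the history of the game up to this round. -/
def conditionalLoss (D : Measure (X × E)) (h : ℝ) (π : P → X → I) (ℓ : E → I → ℝ) (T : ℕ)
    (Q : ℕ → Finset P → P → ℝ) {t : ℕ} (z : Fin t → X × I × ℝ) : ℝ :=
  ∫ y, ℓ y.1.2 y.2 ∂(roundLaw D h (exploreProb (currentEpoch D.fst h π T Q z)) π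
    (Q (currentEpoch D.fst h π T Q z)
      (epochState D.fst h π T Q z (currentEpoch D.fst h π T Q z)).2))

lemma IsOptimizer.mem_stdSimplex_currentEpoch [Nonempty P] {DX : Measure X}
    (hQ : IsOptimizer DX h π Q) {t : ℕ} (z : Fin t → X × I × ℝ) :
    Q (currentEpoch DX h π T Q z)
      (epochState DX h π T Q z (currentEpoch DX h π T Q z)).2 ∈ stdSimplex ℝ P :=
  (hQ _ _ (epochState_nonempty z _)).1.1

lemma measurable_conditionalLoss (hπ : ∀ p, Measurable (π p)) (t : ℕ) :
    Measurable fun z : Fin t → X × I × ℝ => conditionalLoss D h π ℓ T Q z := by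
  unfold conditionalLoss
  refine measurable_of_countable_cases
    (c := fun z : Fin t → X × I × ℝ => currentEpoch D.fst h π T Q z)
    (F := fun k z => ∫ y, ℓ y.1.2 y.2 ∂(roundLaw D h (exploreProb k) π
      (Q k (epochState D.fst h π T Q z k).2)))
    (fun k => measurableSet_currentEpoch_eq hπ t k) fun k => ?_
  exact measurable_of_countable_cases
    (c := fun z : Fin t → X × I × ℝ => epochState D.fst h π T Q z k)
    (F := fun w _ => ∫ y, ℓ y.1.2 y.2 ∂(roundLaw D h (exploreProb k) π (Q k w.2)))
    (fun w => measurableSet_epochState_eq hπ t k w) fun w => measurable_const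

lemma integral_mixDensity_mul_loss [IsProbabilityMeasure D] (hh : 0 < h)
    (hπ : ∀ p, Measurable (π p)) (hℓ : Measurable (Function.uncurry ℓ))
    (hℓ1 : ∀ e a, ℓ e a ∈ Set.Icc (0 : ℝ) 1) (Q : P → ℝ) :
    ∫ y, mixDensity h μ π Q y.1.1 y.2 * ℓ y.1.2 y.2 ∂(D.prod (volume : Measure I)) =
      μ * ∫ y, ℓ y.1.2 y.2 ∂(D.prod (volume : Measure I)) +
        (1 - μ) * ∑ p, Q p * smoothedLoss D ℓ h (π p) := by
  have hi0 : Integrable (fun y : (X × E) × I => ℓ y.1.2 y.2) (D.prod (volume : Measure I)) :=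
    integrable_of_mem_Icc (measurable_loss_round hℓ) (fun y => (hℓ1 _ _).1) fun y => (hℓ1 _ _).2
  have hi1 : ∀ p, Integrable (fun y : (X × E) × I =>
      smoothDensity h (π p y.1.1) y.2 * ℓ y.1.2 y.2) (D.prod (volume : Measure I)) := fun p =>
    integrable_of_mem_Icc ((measurable_smoothDensity_round hπ p).mul (measurable_loss_round hℓ))
      (C := (min h 1)⁻¹ * 1)
      (fun y => mul_nonneg (smoothDensity_nonneg _ _ _) (hℓ1 _ _).1) fun y =>
        mul_le_mul (smoothDensity_le hh _ _) (hℓ1 _ _).2 (hℓ1 _ _).1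
          (inv_nonneg.2 (lt_min hh one_pos).le)
  have hi2 : ∀ p ∈ Finset.univ, Integrable (fun y : (X × E) × I =>
      Q p * (smoothDensity h (π p y.1.1) y.2 * ℓ y.1.2 y.2)) (D.prod (volume : Measure I)) :=
    fun p _ => (hi1 p).const_mul _
  have h1 : ∀ y : (X × E) × I, mixDensity h μ π Q y.1.1 y.2 * ℓ y.1.2 y.2 =
      μ * ℓ y.1.2 y.2 +
        (1 - μ) * ∑ p, Q p * (smoothDensity h (π p y.1.1) y.2 * ℓ y.1.2 y.2) := by
    intro y
    simp only [mixDensity, add_mul, mul_assoc, Finset.sum_mul]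
  simp_rw [h1]
  rw [integral_add (hi0.const_mul _) ((integrable_finsetSum _ hi2).const_mul _),
    integral_const_mul, integral_const_mul, integral_finsetSum _ hi2]
  simp only [integral_const_mul, smoothedLoss_eq hh hℓ hℓ1 hπ]

variable [IsProbabilityMeasure D]

lemma integral_loss_roundLaw_mem_Icc (hh : 0 < h) (hμ0 : 0 ≤ μ) (hμ : μ ≤ 1)
    (hπ : ∀ p, Measurable (π p)) {Q : P → ℝ} (hQ : Q ∈ stdSimplex ℝ P)
    (hℓ1 : ∀ e a, ℓ e a ∈ Set.Icc (0 : ℝ) 1) :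
    ∫ y, ℓ y.1.2 y.2 ∂(roundLaw D h μ π Q) ∈ Set.Icc (0 : ℝ) 1 := by
  have hprob := isProbabilityMeasure_roundLaw (D := D) hh hμ0 hμ hπ hQ
  refine ⟨integral_nonneg fun y => (hℓ1 _ _).1, ?_⟩
  have := integral_mono_of_nonneg (μ := roundLaw D h μ π Q)
    (Filter.Eventually.of_forall fun y : (X × E) × I => (hℓ1 y.1.2 y.2).1)
    (integrable_const (1 : ℝ)) (Filter.Eventually.of_forall fun y => (hℓ1 _ _).2)
  simpa using this

lemma conditionalLoss_mem_Icc [Nonempty P] (hh : 0 < h) (hπ : ∀ p, Measurable (π p))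
    (hℓ1 : ∀ e a, ℓ e a ∈ Set.Icc (0 : ℝ) 1) (hQ : IsOptimizer D.fst h π Q) {t : ℕ}
    (z : Fin t → X × I × ℝ) : conditionalLoss D h π ℓ T Q z ∈ Set.Icc (0 : ℝ) 1 :=
  integral_loss_roundLaw_mem_Icc hh (exploreProb_pos _).le
    ((exploreProb_le_half _).trans (by norm_num)) hπ (hQ.mem_stdSimplex_currentEpoch z) hℓ1

/-- The tower property: the law is cut down to horizon `t + 1`, and the last round is integrated out
first. -/
lemma integral_loss_eq [Nonempty P] (hh : 0 < h) (hπ : ∀ p, Measurable (π p))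
    (hℓ : Measurable (Function.uncurry ℓ)) (hℓ1 : ∀ e a, ℓ e a ∈ Set.Icc (0 : ℝ) 1)
    (hQ : IsOptimizer D.fst h π Q) (t : Fin T) :
    ∫ ω, ℓ (ω t).1.2 (ω t).2 ∂(interactionLaw D ℓ (smoothPolicyElimination D.fst h π T Q) T) =
      ∫ ω, conditionalLoss D h π ℓ T Q (past ℓ ω t)
        ∂(interactionLaw D ℓ (smoothPolicyElimination D.fst h π T Q) T) := by
  have hA := isRegularLearner_smoothPolicyElimination (T := T) hh hπ hQ
  set A := smoothPolicyElimination D.fst h π T Q with hAdef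
  have ht1 : (t : ℕ) + 1 ≤ T := t.2
  have hloss : Measurable fun y : (X × E) × I => ENNReal.ofReal (ℓ y.1.2 y.2) :=
    (measurable_loss_round hℓ).ennreal_ofReal
  have hcl : Measurable fun a : Fin t → (X × E) × I =>
      ENNReal.ofReal (conditionalLoss D h π ℓ T Q (history ℓ a)) :=
    ((measurable_conditionalLoss hπ t).comp (measurable_history hℓ t)).ennreal_ofReal
  have hloss' : Measurable fun ω : Fin (t + 1) → (X × E) × I =>
      ENNReal.ofReal (ℓ (ω (Fin.last t)).1.2 (ω (Fin.last t)).2) :=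
    hloss.comp (measurable_pi_apply (Fin.last (t : ℕ)))
  have hpt : ∀ a : Fin t → (X × E) × I,
      ∫⁻ y, ENNReal.ofReal (A t (history ℓ a) y.1.1 y.2) * ENNReal.ofReal (ℓ y.1.2 y.2)
        ∂(D.prod (volume : Measure I)) =
      ENNReal.ofReal (conditionalLoss D h π ℓ T Q (history ℓ a)) := by
    intro a
    have hQa := hQ.mem_stdSimplex_currentEpoch (T := T) (history ℓ a)
    have hprob := isProbabilityMeasure_roundLaw (D := D) hh
      (exploreProb_pos (currentEpoch D.fst h π T Q (history ℓ a))).le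
      ((exploreProb_le_half _).trans (by norm_num)) hπ hQa
    unfold conditionalLoss
    rw [ofReal_integral_eq_lintegral_ofReal
      (integrable_of_mem_Icc (measurable_loss_round hℓ) (fun y => (hℓ1 _ _).1)
        fun y => (hℓ1 _ _).2) (Filter.Eventually.of_forall fun y => (hℓ1 _ _).1),
      roundLaw, lintegral_withDensity_eq_lintegral_mul _
        (measurable_mixDensity_round hπ).ennreal_ofReal hloss]
    rfl
  have hl : ∫⁻ ω, ENNReal.ofReal (ℓ (ω t).1.2 (ω t).2) ∂(interactionLaw D ℓ A T) =
      ∫⁻ ω, ENNReal.ofReal (conditionalLoss D h π ℓ T Q (past ℓ ω t))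
        ∂(interactionLaw D ℓ A T) := by
    calc ∫⁻ ω, ENNReal.ofReal (ℓ (ω t).1.2 (ω t).2) ∂(interactionLaw D ℓ A T)
        = ∫⁻ ω, ENNReal.ofReal (ℓ (ω (Fin.last t)).1.2 (ω (Fin.last t)).2)
            ∂(interactionLaw D ℓ A (t + 1)) := by
          rw [← map_takeRounds_interactionLaw hℓ hA ht1,
            lintegral_map hloss' (measurable_takeRounds ht1)]
          rfl
      _ = ∫⁻ a, ∫⁻ y, ENNReal.ofReal (A t (history ℓ a) y.1.1 y.2) *
            ENNReal.ofReal (ℓ y.1.2 y.2) ∂(D.prod (volume : Measure I))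
            ∂(interactionLaw D ℓ A t) :=
          lintegral_interactionLaw_succ D hℓ hA t
            (F := fun _ y => ENNReal.ofReal (ℓ y.1.2 y.2)) (hloss.comp measurable_snd)
      _ = ∫⁻ a, ENNReal.ofReal (conditionalLoss D h π ℓ T Q (history ℓ a))
            ∂(interactionLaw D ℓ A t) := lintegral_congr hpt
      _ = ∫⁻ ω, ENNReal.ofReal (conditionalLoss D h π ℓ T Q (past ℓ ω t))
            ∂(interactionLaw D ℓ A T) := by
          rw [← map_takeRounds_interactionLaw hℓ hA t.2.le,
            lintegral_map hcl (measurable_takeRounds t.2.le)]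
          rfl
  have hm1 : Measurable fun ω : Fin T → (X × E) × I => ℓ (ω t).1.2 (ω t).2 := by
    have := (measurable_loss_round hℓ).comp
      (measurable_pi_apply (X := fun _ : Fin T => (X × E) × I) t)
    simpa only [Function.comp_def] using this
  have hm2 : Measurable fun ω : Fin T → (X × E) × I =>
      conditionalLoss D h π ℓ T Q (past ℓ ω t) :=
    (measurable_conditionalLoss hπ t).comp
      ((measurable_history hℓ t).comp (measurable_takeRounds t.2.le))
  rw [integral_eq_lintegral_of_nonneg_ae (Filter.Eventually.of_forall fun ω => (hℓ1 _ _).1)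
      hm1.aestronglyMeasurable,
    integral_eq_lintegral_of_nonneg_ae
      (Filter.Eventually.of_forall fun ω => (conditionalLoss_mem_Icc hh hπ hℓ1 hQ _).1)
      hm2.aestronglyMeasurable, hl]

lemma integrable_conditionalLoss_past [Nonempty P] (hh : 0 < h) (hπ : ∀ p, Measurable (π p))
    (hℓ : Measurable (Function.uncurry ℓ)) (hℓ1 : ∀ e a, ℓ e a ∈ Set.Icc (0 : ℝ) 1)
    (hQ : IsOptimizer D.fst h π Q) (t : Fin T) :
    Integrable (fun ω => conditionalLoss D h π ℓ T Q (past ℓ ω t))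
      (interactionLaw D ℓ (smoothPolicyElimination D.fst h π T Q) T) := by
  have hA := isRegularLearner_smoothPolicyElimination (T := T) hh hπ hQ
  have hprob := isProbabilityMeasure_interactionLaw D hℓ hA T
  refine integrable_of_mem_Icc ?_ (fun ω => (conditionalLoss_mem_Icc hh hπ hℓ1 hQ _).1)
    fun ω => (conditionalLoss_mem_Icc hh hπ hℓ1 hQ _).2
  exact (measurable_conditionalLoss hπ t).comp
      ((measurable_history hℓ t).comp (measurable_takeRounds t.2.le))

/-- The regret is the expected sum of the conditional expectations of the instantaneous regrets. -/
lemma smoothedRegret_eq [Nonempty P] (hh : 0 < h) (hπ : ∀ p, Measurable (π p))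
    (hℓ : Measurable (Function.uncurry ℓ)) (hℓ1 : ∀ e a, ℓ e a ∈ Set.Icc (0 : ℝ) 1)
    (hQ : IsOptimizer D.fst h π Q) :
    smoothedRegret D ℓ h π (smoothPolicyElimination D.fst h π T Q) T =
      ∫ ω, ∑ t : Fin T, (conditionalLoss D h π ℓ T Q (past ℓ ω t) - bench D ℓ h π)
        ∂(interactionLaw D ℓ (smoothPolicyElimination D.fst h π T Q) T) := by
  have hA := isRegularLearner_smoothPolicyElimination (T := T) hh hπ hQ
  have hprob := isProbabilityMeasure_interactionLaw D hℓ hA T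
  have hi := integrable_conditionalLoss_past (T := T) hh hπ hℓ hℓ1 hQ
  unfold smoothedRegret
  rw [integral_finsetSum, integral_finsetSum]
  · simp_rw [integral_loss_eq hh hπ hℓ hℓ1 hQ]
    have : ∀ t : Fin T, ∫ ω, (conditionalLoss D h π ℓ T Q (past ℓ ω t) - bench D ℓ h π)
        ∂(interactionLaw D ℓ (smoothPolicyElimination D.fst h π T Q) T) =
        ∫ ω, conditionalLoss D h π ℓ T Q (past ℓ ω t)
          ∂(interactionLaw D ℓ (smoothPolicyElimination D.fst h π T Q) T) - bench D ℓ h π :=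
      fun t => by rw [integral_sub (hi t) (integrable_const _)]; simp
    simp_rw [this, Finset.sum_sub_distrib]
    simp
  · exact fun t _ => (hi t).sub (integrable_const _)
  · intro t _
    refine integrable_of_mem_Icc ?_ (fun ω => (hℓ1 _ _).1) fun ω => (hℓ1 _ _).2
    have := (measurable_loss_round hℓ).comp
      (measurable_pi_apply (X := fun _ : Fin T => (X × E) × I) t)
    simpa only [Function.comp_def] using this

/-! ### Instantaneous regret when all estimates are accurate. -/

lemma bench_nonneg [Nonempty P] (hh : 0 < h) (hπ : ∀ p, Measurable (π p))
    (hℓ : Measurable (Function.uncurry ℓ)) (hℓ1 : ∀ e a, ℓ e a ∈ Set.Icc (0 : ℝ) 1) :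
    0 ≤ bench D ℓ h π :=
  le_ciInf fun p => (smoothedLoss_mem_Icc hh hℓ hℓ1 hπ p).1

/-- On the event that no estimate is off, the version spaces retain the best policy, and all of
their policies are nearly optimal. -/
lemma mem_epochState_of_notMem_failureSet (hh : 0 < h) (hπ : ∀ p, Measurable (π p))
    (hℓ : Measurable (Function.uncurry ℓ)) (hℓ1 : ∀ e a, ℓ e a ∈ Set.Icc (0 : ℝ) 1)
    (hT : 2 ≤ T) (hP : 2 ≤ Fintype.card P) {ω : Fin T → (X × E) × I}
    (hω : ω ∉ ⋃ k ∈ Finset.range T, ⋃ p ∈ Finset.univ, failureSet D h π ℓ T Q k p) {p₀ : P}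
    (hp₀ : smoothedLoss D ℓ h (π p₀) = bench D ℓ h π) (k : ℕ)
    (hk : (epochState D.fst h π T Q (history ℓ ω) k).1 ≤ T) :
    p₀ ∈ (epochState D.fst h π T Q (history ℓ ω) k).2 ∧
      ∀ p ∈ (epochState D.fst h π T Q (history ℓ ω) k).2,
        smoothedLoss D ℓ h (π p) ≤ bench D ℓ h π + 10 * radius k := by
  have hne : Nonempty P := ⟨p₀⟩
  induction k with
  | zero =>
    refine ⟨Finset.mem_univ _, fun p _ => ?_⟩
    have h1 := (smoothedLoss_mem_Icc (D := D) hh hℓ hℓ1 hπ p).2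
    have h2 := bench_nonneg (D := D) hh hπ hℓ hℓ1
    -- Initially the slack is `10 · 1/2 = 5`, more than any loss.
    have h3 : radius 0 = 1 / 2 := by norm_num [radius]
    rw [h3]
    linarith
  | succ k ih =>
    have hmono := epochState_fst_strictMono (DX := D.fst) (Q := Q) hh hπ hT hP (history ℓ ω)
    have hlt := hmono (Nat.lt_succ_self k)
    simp only at hlt
    obtain ⟨ih1, ih2⟩ := ih (hlt.le.trans hk)
    -- Starts increase strictly, so only epochs with index below `T` can be completed, which are
    -- those in the union bound.
    have hkT : k < T := lt_of_lt_of_le (Nat.lt_succ_self k) (le_trans hmono.le_apply hk)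
    have hacc : ∀ p ∈ (epochState D.fst h π T Q (history ℓ ω) k).2,
        |epochEstimate D.fst h π T Q (history ℓ ω) k
          (epochState D.fst h π T Q (history ℓ ω) k) p - smoothedLoss D ℓ h (π p)| ≤
            radius k := by
      intro p hp
      by_contra hcon
      push Not at hcon
      refine hω (Set.mem_biUnion (x := k) (Finset.mem_coe.2 (Finset.mem_range.2 hkT))
        (Set.mem_biUnion (x := p) (Finset.mem_coe.2 (Finset.mem_univ p)) ⟨hk, hp, hcon⟩))
    have hr : radius k = 2 * radius (k + 1) := by unfold radius; ring
    have hr0 := radius_pos k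
    -- Two estimation errors cost at most `2r`, within the tolerance `3r`, so the best policy stays.
    -- Any survivor is within `3r + 2r = 5r` of it, which is 10 times the next radius.
    refine ⟨mem_epochState_succ_snd.2 ⟨ih1, fun p' hp' => ?_⟩, fun p hp => ?_⟩
    · have h1 := abs_le.1 (hacc p₀ ih1)
      have h2 := abs_le.1 (hacc p' hp')
      have h3 : bench D ℓ h π ≤ smoothedLoss D ℓ h (π p') :=
        ciInf_le (Set.finite_range _).bddBelow p'
      linarith [h1.2, h2.1]
    · obtain ⟨hp1, hp2⟩ := mem_epochState_succ_snd.1 hp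
      have h1 := abs_le.1 (hacc p₀ ih1)
      have h2 := abs_le.1 (hacc p hp1)
      linarith [h1.2, h2.1, hp2 p₀ ih1]

lemma epochState_past_currentEpoch (hh : 0 < h) (hπ : ∀ p, Measurable (π p))
    (hT : 2 ≤ T) (hP : 2 ≤ Fintype.card P) (ω : Fin T → (X × E) × I) (t : Fin T) :
    epochState D.fst h π T Q (past ℓ ω t) (currentEpoch D.fst h π T Q (past ℓ ω t)) =
      epochState D.fst h π T Q (history ℓ ω) (currentEpoch D.fst h π T Q (past ℓ ω t)) := by
  have h1 := (currentEpoch_spec (DX := D.fst) (Q := Q) hh hπ hT hP (past ℓ ω t)).1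
  exact epochState_takeRounds_or t.2.le (history ℓ ω) _ (Or.inr h1)

/-- Survivors contribute `10 r`; uniform exploration has probability `r` and loses at most one. -/
lemma conditionalLoss_sub_bench_le (hh : 0 < h) (hπ : ∀ p, Measurable (π p))
    (hℓ : Measurable (Function.uncurry ℓ)) (hℓ1 : ∀ e a, ℓ e a ∈ Set.Icc (0 : ℝ) 1)
    (hT : 2 ≤ T) (hP : 2 ≤ Fintype.card P) (hQ : IsOptimizer D.fst h π Q)
    {ω : Fin T → (X × E) × I}
    (hω : ω ∉ ⋃ k ∈ Finset.range T, ⋃ p ∈ Finset.univ, failureSet D h π ℓ T Q k p) (t : Fin T) :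
    conditionalLoss D h π ℓ T Q (past ℓ ω t) - bench D ℓ h π ≤
      11 * radius (currentEpoch D.fst h π T Q (past ℓ ω t)) := by
  have hne : Nonempty P := Fintype.card_pos_iff.1 (by omega)
  obtain ⟨p₀, hp₀⟩ := exists_eq_ciInf_of_finite (f := fun p => smoothedLoss D ℓ h (π p))
  have hst := epochState_past_currentEpoch (D := D) (ℓ := ℓ) (Q := Q) hh hπ hT hP ω t
  have h1 := (currentEpoch_spec (DX := D.fst) (Q := Q) hh hπ hT hP (past ℓ ω t)).1
  unfold conditionalLoss
  set k := currentEpoch D.fst h π T Q (past ℓ ω t)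
  rw [hst] at h1 ⊢
  have h2 := (mem_epochState_of_notMem_failureSet hh hπ hℓ hℓ1 hT hP hω hp₀ k
    (h1.trans t.2.le)).2
  set S := (epochState D.fst h π T Q (history ℓ ω) k).2 with hS
  have hQS := (hQ k S (epochState_nonempty _ _)).1
  have hμ0 := exploreProb_pos k
  have hμ1 : exploreProb k ≤ 1 := (exploreProb_le_half k).trans (by norm_num)
  rw [integral_roundLaw hμ0.le hμ1 hπ hQS.1, integral_mixDensity_mul_loss hh hπ hℓ hℓ1]
  have h3 : ∑ p, Q k S p * smoothedLoss D ℓ h (π p) ≤ bench D ℓ h π + 10 * radius k := by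
    calc ∑ p, Q k S p * smoothedLoss D ℓ h (π p)
        ≤ ∑ p, Q k S p * (bench D ℓ h π + 10 * radius k) := by
          refine Finset.sum_le_sum fun p _ => ?_
          by_cases hp : p ∈ S
          · exact mul_le_mul_of_nonneg_left (h2 p hp) (hQS.1.1 p)
          · simp [hQS.2 p hp]
      _ = _ := by rw [← Finset.sum_mul, hQS.1.2, one_mul]
  have h4 : ∫ y : (X × E) × I, ℓ y.1.2 y.2 ∂(D.prod (volume : Measure I)) ≤ 1 := by
    have := integral_mono_of_nonneg (μ := D.prod (volume : Measure I))
      (Filter.Eventually.of_forall fun y : (X × E) × I => (hℓ1 y.1.2 y.2).1)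
      (integrable_const (1 : ℝ)) (Filter.Eventually.of_forall fun y => (hℓ1 _ _).2)
    simpa using this
  have h5 := bench_nonneg (D := D) hh hπ hℓ hℓ1
  have h6 := exploreProb_eq k
  have h7 := radius_pos k
  have h8 := mul_le_mul_of_nonneg_left h4 hμ0.le
  have h9 := mul_le_mul_of_nonneg_left h3 (sub_nonneg.2 hμ1)
  have h10 : 0 ≤ exploreProb k * (bench D ℓ h π + 10 * radius k) := by positivity
  linarith

/-! ### Summing the radii over all rounds. -/

lemma batchSize_le (DX : Measure X) [IsProbabilityMeasure DX] (hh : 0 < h)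
    (hπ : ∀ p, Measurable (π p)) (k : ℕ) (S : Finset P) :
    (batchSize DX h π k S : ℝ) ≤ 320 / (radius k ^ 2 * h) + 1 := by
  have hr := radius_pos k
  have hV : 0 ≤ charVolume DX h π S := by
    rw [charVolume_eq DX hπ]; exact measureReal_nonneg
  refine (Nat.ceil_lt_add_one (by positivity)).le.trans ?_
  gcongr
  linarith [charVolume_le_one (h := h) DX hπ S]

lemma radius_mul_epochLength_le (DX : Measure X) [IsProbabilityMeasure DX] (hh : 0 < h)
    (hπ : ∀ p, Measurable (π p)) (k : ℕ) (S : Finset P) :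
    radius k * epochLength DX h π T k S ≤
      numBatches T (Fintype.card P) * (320 / h * 2 ^ (k + 1) + (1 / 2) ^ (k + 1)) := by
  have hr := radius_pos k
  have h1 := batchSize_le DX hh hπ k S
  have h2 : radius k * (2 : ℝ) ^ (k + 1) = 1 := by
    unfold radius
    rw [← mul_pow]; norm_num
  unfold epochLength
  push_cast
  calc radius k * (batchSize DX h π k S * numBatches T (Fintype.card P))
      ≤ radius k * ((320 / (radius k ^ 2 * h) + 1) * numBatches T (Fintype.card P)) := by gcongr
    _ = numBatches T (Fintype.card P) * (320 / h * (radius k)⁻¹ + radius k) := by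
        field_simp
    _ = _ := by rw [inv_eq_of_mul_eq_one_right h2]; rfl

/-- A bound on the sum of the radii of the epochs over all rounds. -/
lemma sum_radius_currentEpoch_le (hh : 0 < h) (hπ : ∀ p, Measurable (π p))
    (hT : 2 ≤ T) (hP : 2 ≤ Fintype.card P) (ω : Fin T → (X × E) × I) (K : ℕ) :
    ∑ t : Fin T, radius (currentEpoch D.fst h π T Q (past ℓ ω t)) ≤
      T * radius K + numBatches T (Fintype.card P) * (320 / h * 2 ^ (K + 1) + 1) := by
  classical
  set s : ℕ → ℕ := fun k => (epochState D.fst h π T Q (history ℓ ω) k).1 with hs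
  -- Rounds from epoch `K` on cost at most `radius K` each; earlier ones are charged to the interval
  -- of their own epoch.
  have hpt : ∀ t : Fin T, radius (currentEpoch D.fst h π T Q (past ℓ ω t)) ≤
      radius K + ∑ k ∈ Finset.range K,
        if s k ≤ (t : ℕ) ∧ (t : ℕ) < s (k + 1) then radius k else 0 := by
    intro t
    obtain ⟨h1, h2⟩ := currentEpoch_spec (DX := D.fst) (Q := Q) hh hπ hT hP (past ℓ ω t)
    have hst := epochState_past_currentEpoch (D := D) (ℓ := ℓ) (Q := Q) hh hπ hT hP ω t
    rw [epochState_succ_fst] at h2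
    rw [hst] at h1 h2
    rw [← epochState_succ_fst] at h2
    set k := currentEpoch D.fst h π T Q (past ℓ ω t)
    have hnn : ∀ j ∈ Finset.range K,
        0 ≤ if s j ≤ (t : ℕ) ∧ (t : ℕ) < s (j + 1) then radius j else 0 := fun j _ => by
      split_ifs
      · exact (radius_pos j).le
      · exact le_rfl
    rcases lt_or_ge k K with hkK | hkK
    · have := Finset.single_le_sum hnn (Finset.mem_range.2 hkK)
      rw [if_pos ⟨h1, h2⟩] at this
      linarith [radius_pos K]
    · have h3 : radius k ≤ radius K :=
        pow_le_pow_of_le_one (by norm_num) (by norm_num) (by omega)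
      linarith [Finset.sum_nonneg hnn]
  have hcount : ∀ k, ((Finset.univ.filter fun t : Fin T =>
      s k ≤ (t : ℕ) ∧ (t : ℕ) < s (k + 1)).card : ℝ) ≤
        epochLength D.fst h π T k (epochState D.fst h π T Q (history ℓ ω) k).2 := by
    intro k
    have h1 : (Finset.univ.filter fun t : Fin T => s k ≤ (t : ℕ) ∧ (t : ℕ) < s (k + 1)).card ≤
        (Finset.Ico (s k) (s (k + 1))).card := by
      refine Finset.card_le_card_of_injOn (fun t : Fin T => (t : ℕ)) (fun t ht => ?_)
        fun t _ t' _ htt' => Fin.ext htt'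
      simpa using ht
    have h2 : s (k + 1) = s k +
      epochLength D.fst h π T k (epochState D.fst h π T Q (history ℓ ω) k).2 := rfl
    rw [Nat.card_Ico, h2, Nat.add_sub_cancel_left] at h1
    exact_mod_cast h1
  have hgeom1 : ∀ K : ℕ, ∑ k ∈ Finset.range K, (2 : ℝ) ^ (k + 1) ≤ 2 ^ (K + 1) := by
    intro K
    induction K with
    | zero => simp
    | succ K ih => rw [Finset.sum_range_succ, pow_succ 2 (K + 1)]; linarith
  have hgeom2 : ∀ K : ℕ, ∑ k ∈ Finset.range K, (1 / 2 : ℝ) ^ (k + 1) = 1 - (1 / 2) ^ K := by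
    intro K
    induction K with
    | zero => simp
    | succ K ih => rw [Finset.sum_range_succ, ih]; ring
  calc ∑ t : Fin T, radius (currentEpoch D.fst h π T Q (past ℓ ω t))
      ≤ ∑ t : Fin T, (radius K + ∑ k ∈ Finset.range K,
          if s k ≤ (t : ℕ) ∧ (t : ℕ) < s (k + 1) then radius k else 0) :=
        Finset.sum_le_sum fun t _ => hpt t
    _ = T * radius K + ∑ k ∈ Finset.range K, radius k * ((Finset.univ.filter fun t : Fin T =>
          s k ≤ (t : ℕ) ∧ (t : ℕ) < s (k + 1)).card : ℝ) := by
        rw [Finset.sum_add_distrib, Finset.sum_comm]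
        congr 1
        · simp
        · refine Finset.sum_congr rfl fun k _ => ?_
          rw [← Finset.sum_filter, Finset.sum_const, nsmul_eq_mul, mul_comm]
    _ ≤ T * radius K + ∑ k ∈ Finset.range K, numBatches T (Fintype.card P) *
          (320 / h * 2 ^ (k + 1) + (1 / 2) ^ (k + 1)) := by
        refine add_le_add le_rfl (Finset.sum_le_sum fun k _ => ?_)
        exact (mul_le_mul_of_nonneg_left (hcount k) (radius_pos k).le).trans
          (radius_mul_epochLength_le D.fst hh hπ k _)
    _ ≤ _ := by
        rw [← Finset.mul_sum, Finset.sum_add_distrib, ← Finset.mul_sum, hgeom2]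
        gcongr
        · exact hgeom1 K
        · have : (0 : ℝ) ≤ (1 / 2) ^ K := by positivity
          linarith

lemma sum_radius_le_sqrt (hh : 0 < h) (hh1 : h ≤ 1) (hπ : ∀ p, Measurable (π p))
    (hT : 2 ≤ T) (hP : 2 ≤ Fintype.card P) (ω : Fin T → (X × E) × I)
    (hd : (numBatches T (Fintype.card P) : ℝ) ≤ T * h) :
    ∑ t : Fin T, radius (currentEpoch D.fst h π T Q (past ℓ ω t)) ≤
      642 * √(numBatches T (Fintype.card P) * T / h) := by
  set d : ℝ := ((numBatches T (Fintype.card P) : ℕ) : ℝ) with hd_def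
  have hd0 : 0 < d := Nat.cast_pos.2 (numBatches_pos hT hP)
  have hT0 : (0 : ℝ) < T := by exact_mod_cast (by omega : 0 < T)
  set ρ := √(d / (T * h)) with hρ
  have hρ0 : 0 < ρ := Real.sqrt_pos.2 (by positivity)
  have hρ1 : ρ ≤ 1 := Real.sqrt_le_one.2 ((div_le_one (by positivity)).2 hd)
  have hρsq : ρ ^ 2 = d / (T * h) := Real.sq_sqrt (by positivity)
  -- `ρ` balances `T ρ` against `d / (h ρ)`, and `K` makes `radius K` equal to `ρ` up to a factor 2.
  -- The hypothesis `hd` is what gives `ρ ≤ 1`.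
  obtain ⟨K, hK1, hK2⟩ := exists_nat_pow_near_of_lt_one hρ0 hρ1
    (by norm_num : (0 : ℝ) < 1 / 2) (by norm_num)
  have h1 := sum_radius_currentEpoch_le (D := D) (ℓ := ℓ) (Q := Q) hh hπ hT hP ω K
  have hsq : √(d * T / h) = T * ρ := by
    rw [Real.sqrt_eq_iff_mul_self_eq (by positivity) (by positivity), ← sq, mul_pow, hρsq]
    field_simp
  have h2 : (2 : ℝ) ^ (K + 1) ≤ 2 / ρ := by
    have h3 : (2 : ℝ) ^ (K + 1) = 2 / (1 / 2) ^ K := by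
      rw [pow_succ, one_div, inv_pow]; field_simp
    rw [h3]
    gcongr
  have h4 : d / h * (1 / ρ) = T * ρ := by
    have : d / h = T * ρ ^ 2 := by rw [hρsq]; field_simp
    rw [this]; field_simp
  have h5 : d ≤ T * ρ := by
    rw [← hsq]
    refine Real.le_sqrt_of_sq_le ?_
    rw [le_div_iff₀ hh, sq, mul_assoc]
    gcongr
    calc d * h ≤ d * 1 := by gcongr
      _ ≤ T * h := by linarith
      _ ≤ T := by nlinarith
  calc ∑ t : Fin T, radius (currentEpoch D.fst h π T Q (past ℓ ω t))
      ≤ T * radius K + d * (320 / h * 2 ^ (K + 1) + 1) := h1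
    _ ≤ T * ρ + d * (320 / h * (2 / ρ) + 1) := by
        gcongr
        exact hK1.le
    -- The three terms are the late epochs, the early epochs and the rounding of batch sizes; each
    -- unit is at most `T ρ`, whence `642 = 1 + 640 + 1`.
    _ = T * ρ + 640 * (d / h * (1 / ρ)) + d := by ring
    _ ≤ 642 * √(d * T / h) := by rw [h4, hsq]; linarith

/-- Here `7063 = 11 · 642 + 1`. The last unit covers failure, which costs at most `T` with
probability at most `1/T`. -/
lemma smoothedRegret_le_sqrt (hh : 0 < h) (hh1 : h ≤ 1) (hπ : ∀ p, Measurable (π p))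
    (hℓ : Measurable (Function.uncurry ℓ)) (hℓ1 : ∀ e a, ℓ e a ∈ Set.Icc (0 : ℝ) 1)
    (hT : 2 ≤ T) (hP : 2 ≤ Fintype.card P) (hQ : IsOptimizer D.fst h π Q) :
    smoothedRegret D ℓ h π (smoothPolicyElimination D.fst h π T Q) T ≤
      7063 * √(numBatches T (Fintype.card P) * T / h) := by
  have hne : Nonempty P := Fintype.card_pos_iff.1 (by omega)
  have hA := isRegularLearner_smoothPolicyElimination (T := T) hh hπ hQ
  have hprob := isProbabilityMeasure_interactionLaw D hℓ hA T
  have hi := integrable_conditionalLoss_past (T := T) hh hπ hℓ hℓ1 hQ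
  rw [smoothedRegret_eq hh hπ hℓ hℓ1 hQ]
  set m := interactionLaw D ℓ (smoothPolicyElimination D.fst h π T Q) T
  set d : ℝ := ((numBatches T (Fintype.card P) : ℕ) : ℝ) with hd_def
  have hT0 : (0 : ℝ) < T := by exact_mod_cast (by omega : 0 < T)
  have hd1 : 1 ≤ d := Nat.one_le_cast.2 (numBatches_pos hT hP)
  have hb := bench_nonneg (D := D) hh hπ hℓ hℓ1
  have hint : Integrable (fun ω => ∑ t : Fin T,
      (conditionalLoss D h π ℓ T Q (past ℓ ω t) - bench D ℓ h π)) m :=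
    integrable_finsetSum _ fun t _ => (hi t).sub (integrable_const _)
  have htriv : ∀ ω : Fin T → (X × E) × I, ∑ t : Fin T,
      (conditionalLoss D h π ℓ T Q (past ℓ ω t) - bench D ℓ h π) ≤ T := by
    intro ω
    calc _ ≤ ∑ t : Fin T, (1 : ℝ) := Finset.sum_le_sum fun t _ => by
            linarith [(conditionalLoss_mem_Icc (T := T) hh hπ hℓ1 hQ (past ℓ ω t)).2]
      _ = T := by simp
  rcases le_total d (T * h) with hd | hd
  -- A measurable hull of the same measure avoids proving the failure event measurable.
  · set F := toMeasurable m
      (⋃ k ∈ Finset.range T, ⋃ p ∈ Finset.univ, failureSet D h π ℓ T Q k p) with hF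
    have hFm : MeasurableSet F := measurableSet_toMeasurable _ _
    have hFmeas : T * m.real F ≤ 1 := by
      have h1 := mul_measure_iUnion_failureSet_le hh hh1 hπ hℓ hℓ1 hT hP hQ
      rw [← measure_toMeasurable] at h1
      have h2 := ENNReal.toReal_mono ENNReal.one_ne_top h1
      rwa [ENNReal.toReal_mul, ENNReal.toReal_natCast, ENNReal.toReal_one] at h2
    have hpt : ∀ ω, ∑ t : Fin T, (conditionalLoss D h π ℓ T Q (past ℓ ω t) - bench D ℓ h π) ≤
        F.indicator (fun _ => (T : ℝ)) ω + 7062 * √(d * T / h) := by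
      intro ω
      have hs0 := Real.sqrt_nonneg (d * T / h)
      by_cases hω : ω ∈ F
      · rw [Set.indicator_of_mem hω]
        linarith [htriv ω]
      · rw [Set.indicator_of_notMem hω, zero_add]
        have hω' := fun h' => hω (subset_toMeasurable m _ h')
        calc _ ≤ ∑ t : Fin T, 11 * radius (currentEpoch D.fst h π T Q (past ℓ ω t)) :=
              Finset.sum_le_sum fun t _ =>
                conditionalLoss_sub_bench_le hh hπ hℓ hℓ1 hT hP hQ hω' t
          _ ≤ 11 * (642 * √(d * T / h)) := by
              rw [← Finset.mul_sum]
              gcongr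
              exact sum_radius_le_sqrt hh hh1 hπ hT hP ω hd
          _ = _ := by ring
    have hFi : Integrable (F.indicator fun _ => (T : ℝ)) m :=
      (integrable_const (T : ℝ)).indicator hFm
    have h1 := integral_mono hint (hFi.add (integrable_const (7062 * √(d * T / h)))) hpt
    simp only [Pi.add_apply] at h1
    rw [integral_add hFi (integrable_const _), integral_indicator hFm, setIntegral_const,
      integral_const, probReal_univ, one_smul, smul_eq_mul] at h1
    have h2 : 1 ≤ √(d * T / h) := by
      refine Real.one_le_sqrt.2 ((one_le_div hh).2 ?_)
      have : (1 : ℝ) ≤ T := by exact_mod_cast (by omega : 1 ≤ T)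
      nlinarith
    linarith [mul_comm (m.real F) T]
  -- When `d ≥ T h`, the claimed bound exceeds the trivial bound `T`.
  · have h1 := integral_mono hint (integrable_const (T : ℝ)) htriv
    rw [integral_const, probReal_univ, one_smul] at h1
    have h2 : (T : ℝ) ≤ √(d * T / h) := by
      refine Real.le_sqrt_of_sq_le ?_
      rw [le_div_iff₀ hh]
      nlinarith
    linarith [Real.sqrt_nonneg (d * T / h)]

/-- If every ball is the whole action set, then the algorithm has no regret. -/
lemma smoothedRegret_eq_zero (hh : 1 ≤ h) (hπ : ∀ p, Measurable (π p))
    (hℓ : Measurable (Function.uncurry ℓ)) (hℓ1 : ∀ e a, ℓ e a ∈ Set.Icc (0 : ℝ) 1)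
    [Nonempty P] (hQ : IsOptimizer D.fst h π Q) :
    smoothedRegret D ℓ h π (smoothPolicyElimination D.fst h π T Q) T = 0 := by
  have hh0 : 0 < h := one_pos.trans_le hh
  have h1 : bench D ℓ h π =
      ∫ y : (X × E) × I, ℓ y.1.2 y.2 ∂(D.prod (volume : Measure I)) := by
    simp [bench, smoothedLoss_eq hh0 hℓ hℓ1 hπ, smoothDensity_of_one_le hh]
  have h2 : ∀ (t : ℕ) (z : Fin t → X × I × ℝ), conditionalLoss D h π ℓ T Q z =
      ∫ y : (X × E) × I, ℓ y.1.2 y.2 ∂(D.prod (volume : Measure I)) := by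
    intro t z
    have hQz := hQ.mem_stdSimplex_currentEpoch (T := T) z
    unfold conditionalLoss
    rw [integral_roundLaw (exploreProb_pos _).le ((exploreProb_le_half _).trans (by norm_num))
      hπ hQz]
    simp only [mixDensity_of_one_le hh π hQz.2, one_mul]
  rw [smoothedRegret_eq hh0 hπ hℓ hℓ1 hQ]
  simp [h1, h2]

end Regret

/-- Both logarithms are at least `log 2 > 0.69`, so sums and additive constants can be absorbed into
products. The square on `log T` makes the later square root exact. -/
lemma numBatches_le {T N : ℕ} (hT : 2 ≤ T) (hN : 2 ≤ N) :
    (numBatches T N : ℝ) ≤ 64 * Real.log T ^ 2 * Real.log N := by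
  have hT' : (2 : ℝ) ≤ T := by exact_mod_cast hT
  have hN' : (2 : ℝ) ≤ N := by exact_mod_cast hN
  have ha : 0.69 ≤ Real.log T :=
    (by linarith [Real.log_two_gt_d9] : (0.69 : ℝ) ≤ Real.log 2).trans
      (Real.log_le_log (by norm_num) hT')
  have hb : 0.69 ≤ Real.log N :=
    (by linarith [Real.log_two_gt_d9] : (0.69 : ℝ) ≤ Real.log 2).trans
      (Real.log_le_log (by norm_num) hN')
  obtain ⟨h1, h2⟩ := four_le_mul_and_mul_le_mul_logb hT hN
  have hlogb : Real.logb 2 T ≤ 2 * Real.log T := by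
    rw [Real.logb, div_le_iff₀ (Real.log_pos (by norm_num))]
    nlinarith [Real.log_two_gt_d9]
  have hlogT : Real.log T ≤ T := (Real.log_le_sub_one_of_pos (by linarith)).trans (by linarith)
  have hle : T * N * Real.logb 2 T ≤ T * N * (2 * T) := by
    gcongr
    linarith
  have hlog : Real.log (T * N * Real.logb 2 T) ≤ 3 * Real.log T + Real.log N := by
    calc Real.log (T * N * Real.logb 2 T) ≤ Real.log (T * N * (2 * T)) :=
          Real.log_le_log (by linarith) hle
      _ = Real.log T + Real.log N + (Real.log 2 + Real.log T) := by
          rw [Real.log_mul (by positivity) (by positivity), Real.log_mul (by positivity)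
            (by positivity), Real.log_mul (by positivity) (by positivity)]
      _ ≤ _ := by linarith [Real.log_le_log (by norm_num : (0 : ℝ) < 2) hT']
  have hceil := Nat.ceil_lt_add_one (Real.log_nonneg (by linarith : 1 ≤ T * N * Real.logb 2 T))
  have hd : (numBatches T N : ℝ) = 5 * (⌈Real.log (T * N * Real.logb 2 T)⌉₊ : ℝ) := by
    unfold numBatches; push_cast; ring
  rw [hd]
  set a := Real.log T
  set b := Real.log N
  have hab : 0.69 * a ≤ a * b := by nlinarith
  have hab2 : 0.69 * b ≤ a * b := by nlinarith
  -- With the factor 5 and the next estimate, `5 · 8 · 1.5 = 60 ≤ 64`.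
  have h3 : 3 * a + b + 1 ≤ 8 * (a * b) := by nlinarith
  have h4 : a * b ≤ 1.5 * (a ^ 2 * b) := by
    nlinarith [mul_nonneg (by linarith : 0 ≤ a * b) (by linarith : 0 ≤ a - 0.69)]
  nlinarith

end SmoothedBandit

end

open SmoothedBandit
theorem corollary2 :
    ∃ (C : ℝ) (c : ℕ), 0 < C ∧
      ∀ (X E P : Type*) [MeasurableSpace X] [MeasurableSpace E] [Fintype P]
        (D : Measure (X × E)) [IsProbabilityMeasure D]
        (ℓ : E → I → ℝ) (_ : Measurable (Function.uncurry ℓ)) (_ : ∀ e a, ℓ e a ∈ Set.Icc (0 : ℝ) 1)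
        (π : P → X → I) (_ : ∀ p, Measurable (π p)) (_ : 2 ≤ Fintype.card P)
        (h : ℝ) (_ : 0 < h) (T : ℕ) (_ : 2 ≤ T),
        (∃ Q, IsOptimizer D.fst h π Q) ∧
        ∀ Q, IsOptimizer D.fst h π Q →
          IsProbabilityMeasure
            (interactionLaw D ℓ (smoothPolicyElimination D.fst h π T Q) T) ∧
          smoothedRegret D ℓ h π (smoothPolicyElimination D.fst h π T Q) T ≤
            C * Real.log T ^ c * √(T / h * Real.log (Fintype.card P)) := by
  -- The factor `8 * log T` is the square root of the `64 * log² T` in the bound for the number of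
  -- batches.
  refine ⟨7063 * 8, 1, by norm_num, ?_⟩
  intro X E P _ _ _ D _ ℓ hℓ hℓ1 π hπ hP h hh T hT
  refine ⟨exists_isOptimizer D.fst hh hπ, fun Q hQ => ?_⟩
  have hne : Nonempty P := Fintype.card_pos_iff.1 (by omega)
  refine ⟨isProbabilityMeasure_interactionLaw D hℓ
    (isRegularLearner_smoothPolicyElimination hh hπ hQ) T, ?_⟩
  have hlog : 0 ≤ Real.log T := Real.log_natCast_nonneg T
  -- Smoothed densities are bounded by `1/h` only for `h ≤ 1`. For `h ≥ 1` every ball is the whole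
  -- action set and every policy has the same smoothed loss.
  rcases le_total h 1 with hh1 | hh1
  · refine (smoothedRegret_le_sqrt hh hh1 hπ hℓ hℓ1 hT hP hQ).trans ?_
    have h1 : √(numBatches T (Fintype.card P) * T / h) ≤
        8 * Real.log T * √(T / h * Real.log (Fintype.card P)) := by
      rw [← Real.sqrt_sq (by positivity : 0 ≤ 8 * Real.log T), ← Real.sqrt_mul (sq_nonneg _)]
      refine Real.sqrt_le_sqrt ?_
      calc (numBatches T (Fintype.card P) : ℝ) * T / h
          ≤ 64 * Real.log T ^ 2 * Real.log (Fintype.card P) * T / h := by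
            gcongr
            exact numBatches_le hT hP
        _ = _ := by ring
    rw [pow_one]
    linarith
  · rw [smoothedRegret_eq_zero hh1 hπ hℓ hℓ1 hQ]
    positivity
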